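/- A colourful point configuration in $\mathbb{R}^d$ consists of $d+1$ sets (colours) $\mathbf{S}_1,\dots,\mathbf{S}_{d+1}\subset\mathbb{R}^d$, each of $d+1$ points, with $\mathbf{0}\in\bigcap_{i}\operatorname{conv}(\mathbf{S}_i)$. A colourful simplex is $\operatorname{conv}\{s_1,\dots,s_{d+1}\}$ for a choice of $s_i\in\mathbf{S}_i$, $i=1,\dots,d+1$; colourful simplices are counted by their vertex choices $(s_1,\dots,s_{d+1})$. Let $\mu(d)$ be the minimum number of colourful simplices containing $\mathbf{0}$ over all colourful point configurations in $\mathbb{R}^d$. An $(m_1,\dots,m_n)$-octahedral system is an $n$-partite $n$-uniform hypergraph with disjoint vertex classes $V_1,\dots,V_n$, $|V_i|=m_i\ge 2$, every edge meeting each $V_i$ in exactly one vertex, such that for every $X\subseteq\bigcup_i V_i$ with $|X\cap V_i|=2$ for all $i$, the number of edges contained in $X$ is even. Let $\nu(m_1,\dots,m_n)$ be the minimum number of edges over all $(m_1,\dots,m_n)$-octahedral systems in which every vertex lies in at least one edge. Proposition. $\mu(4)=17$; that is, the conjectured equality $\mu(d)=d^2+1$ holds for $d=4$. The minimum is also $17$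 if it is taken only over the configurations in general position, meaning that the points of all colours together with $\mathbf{0}$ are pairwise distinct and any $d+1$ or fewer of them are affinely independent. Moreover, $\nu(5,5,5,5,5)=17$. -/

import Mathlib

/-- An `(m₁, …, mₙ)`-octahedral system on the vertex classes `Vᵢ = Fin (m i)`, each with at least two
vertices. An edge meets each class in exactly one vertex, so it is given by its vertex `e i` in each
class. A set `X` of vertices is given by its traces `X i` on the classes. -/
structure OctahedralSystem {n : ℕ} (m : Fin n → ℕ) where
  edges : Finset (∀ i, Fin (m i))
  two_le : ∀ i, 2 ≤ m i
  parity : ∀ X : ∀ i, Finset (Fin (m i)), (∀ i, (X i).card = 2) →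
    Even (edges.filter (fun e => ∀ i, e i ∈ X i)).card

/-- Every vertex `v` (of every class `i`) belongs to at least one edge. -/
def OctahedralSystem.WithoutIsolatedVertex {n : ℕ} {m : Fin n → ℕ} (Ω : OctahedralSystem m) : Prop :=
  ∀ (i : Fin n) (v : Fin (m i)), ∃ e ∈ Ω.edges, e i = v

/-- `ν(m₁, …, mₙ)`: the minimum number of edges over all `(m₁, …, mₙ)`-octahedral systems without
isolated vertex. (A nonzero value of `sInf` on sets of natural numbers is an attained minimum.) -/
noncomputable def nu {n : ℕ} (m : Fin n → ℕ) : ℕ :=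
  sInf {k | ∃ Ω : OctahedralSystem m, Ω.WithoutIsolatedVertex ∧ Ω.edges.card = k}

/-- A colourful point configuration in `ℝᵈ`: colours `S 0, …, S d`, each of which consists of `d + 1`
points and has the origin in its convex hull. -/
structure IsColourfulConfiguration (d : ℕ)
    (S : Fin (d + 1) → Finset (EuclideanSpace ℝ (Fin d))) : Prop where
  card_eq : ∀ i, (S i).card = d + 1
  zero_mem : ∀ i, (0 : EuclideanSpace ℝ (Fin d)) ∈
    convexHull ℝ (S i : Set (EuclideanSpace ℝ (Fin d)))

/-- The points of all colours, together with the origin, are pairwise distinct, and any `d + 1` or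
fewer of them are affinely independent. -/
structure IsInGeneralPosition (d : ℕ)
    (S : Fin (d + 1) → Finset (EuclideanSpace ℝ (Fin d))) : Prop where
  zero_notMem : ∀ i, (0 : EuclideanSpace ℝ (Fin d)) ∉ S i
  disjoint : ∀ i j, i ≠ j → Disjoint (S i) (S j)
  affineIndependent : ∀ T : Finset (EuclideanSpace ℝ (Fin d)),
    (∀ x ∈ T, x = 0 ∨ ∃ i, x ∈ S i) → T.card ≤ d + 1 →
      AffineIndependent ℝ (fun x : T => (x : EuclideanSpace ℝ (Fin d)))

open Classical in
/-- The number of colourful simplices containing the origin. A colourful simplex is the convex hull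
of a choice `s` of one point of each colour; simplices are counted by their vertex choices. -/
noncomputable def colourfulDepth (d : ℕ)
    (S : Fin (d + 1) → Finset (EuclideanSpace ℝ (Fin d))) : ℕ :=
  ((Fintype.piFinset S).filter (fun s =>
    (0 : EuclideanSpace ℝ (Fin d)) ∈ convexHull ℝ (Set.range s))).card

/-- `μ(d)`: the minimum number of colourful simplices containing the origin, over all colourful point
configurations. -/
noncomputable def mu (d : ℕ) : ℕ :=
  sInf {k | ∃ S, IsColourfulConfiguration d S ∧ colourfulDepth d S = k}

/-- The same minimum, over the colourful point configurations in general position only. -/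
noncomputable def muGeneralPosition (d : ℕ) : ℕ :=
  sInf {k | ∃ S, IsColourfulConfiguration d S ∧ IsInGeneralPosition d S ∧ colourfulDepth d S = k}

/-! After a suitable perturbation, the choices whose simplex contains the origin form an octahedral
system. So the lower bounds are combinatorial, and one degenerate labelled configuration gives all
the upper bounds.

Combinatorics. A nonempty octahedral system on classes of size five that covers `c ≤ 5` classes has
at least `3 c + 2` edges (`IsOctahedral.three_mul_card_add_two_le`); `c = 5` gives 17. The proof is
by induction on the number of classes. In a covered class, let `L` be the link of a vertex of least
degree. The symmetric difference `F v` of `L` and the link of `v` is again octahedral, so induction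
applies when it is nonempty. Each other covered class is covered by a single `F v`, and then counts
in the bound for it, or only by `L` and several `F v` jointly. The latter is expensive: a system
that misses a vertex of a class has at least five edges through every vertex of that class that it
uses. Comparing the sizes of the `F v` with the degrees settles everything except some cases with
two edges in `L`; there all `F v` but one lie on a common line, and the exceptional one must cover
the other classes.

Geometry. Missing the origin is an open condition and positive rescaling does not affect it, so a
configuration can be made generic with colours summing to zero without creating containing
simplices. Parity then follows by counting modulo two the facets crossed by a generic ray
(`LinearlyGeneric.even_card_containingChoices`), and colourful Carathéodory puts every point in a
containing simplex (`LinearlyGeneric.exists_mem_convexHull_transversal`).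

Upper bounds. `seventeenPoint` has at most 17 containing choices. Perturbing it yields both a
configuration in general position and an octahedral system with no more. -/

open Finset Filter Topology symmDiff

/-! ### Links in octahedral systems -/

/-- The parity condition of an octahedral system with classes of size five. -/
def IsOctahedral {n : ℕ} (E : Finset (Fin n → Fin 5)) : Prop :=
  ∀ X : Fin n → Finset (Fin 5), (∀ i, (X i).card = 2) →
    Even (E.filter (fun e => ∀ i, e i ∈ X i)).card

/-- The link of the vertex `u` of class `i`. -/
def link {n : ℕ} (i : Fin (n + 1)) (u : Fin 5) (E : Finset (Fin (n + 1) → Fin 5)) :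
    Finset (Fin n → Fin 5) :=
  univ.filter (fun g => (i.insertNth u g : Fin (n + 1) → Fin 5) ∈ E)

/-- The vertices of class `j` that belong to an edge. -/
def usedVertices {n : ℕ} (E : Finset (Fin n → Fin 5)) (j : Fin n) : Finset (Fin 5) :=
  E.image (fun e => e j)

theorem mem_link {n : ℕ} {i : Fin (n + 1)} {u : Fin 5} {E : Finset (Fin (n + 1) → Fin 5)}
    {g : Fin n → Fin 5} : g ∈ link i u E ↔ (i.insertNth u g : Fin (n + 1) → Fin 5) ∈ E := by
  simp [link]

theorem mem_usedVertices {n : ℕ} {E : Finset (Fin n → Fin 5)} {j : Fin n} {u : Fin 5} :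
    u ∈ usedVertices E j ↔ ∃ e ∈ E, e j = u := by
  simp [usedVertices]

theorem removeNth_mem_link {n : ℕ} {i : Fin (n + 1)} {E : Finset (Fin (n + 1) → Fin 5)}
    {e : Fin (n + 1) → Fin 5} (he : e ∈ E) : i.removeNth e ∈ link i (e i) E := by
  rw [mem_link]
  simpa using he

theorem link_nonempty_iff {n : ℕ} {i : Fin (n + 1)} {u : Fin 5}
    {E : Finset (Fin (n + 1) → Fin 5)} : (link i u E).Nonempty ↔ u ∈ usedVertices E i := by
  rw [mem_usedVertices]
  constructor
  · rintro ⟨g, hg⟩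
    exact ⟨_, mem_link.1 hg, by simp⟩
  · rintro ⟨e, he, rfl⟩
    exact ⟨_, removeNth_mem_link he⟩

theorem insertNth_right_injective {n : ℕ} (i : Fin (n + 1)) (u : Fin 5) :
    Function.Injective (fun g : Fin n → Fin 5 => (i.insertNth u g : Fin (n + 1) → Fin 5)) :=
  fun g g' h => by simpa using congrArg (Fin.removeNth i) h

theorem card_filter_link {n : ℕ} (i : Fin (n + 1)) (u : Fin 5)
    (E : Finset (Fin (n + 1) → Fin 5)) (p : (Fin (n + 1) → Fin 5) → Prop) [DecidablePred p] :
    ((link i u E).filter (fun g => p (i.insertNth u g))).card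
      = (E.filter (fun e => p e ∧ e i = u)).card := by
  rw [← card_image_of_injective _ (insertNth_right_injective i u)]
  congr 1
  ext e
  simp only [mem_image, mem_filter, mem_link]
  constructor
  · rintro ⟨g, ⟨hg, hp⟩, rfl⟩
    exact ⟨hg, hp, by simp⟩
  · rintro ⟨he, hp, rfl⟩
    exact ⟨i.removeNth e, by simpa using ⟨he, hp⟩, by simp⟩

theorem card_link {n : ℕ} (i : Fin (n + 1)) (u : Fin 5) (E : Finset (Fin (n + 1) → Fin 5)) :
    (link i u E).card = (E.filter (fun e => e i = u)).card := by
  simpa using card_filter_link i u E (fun _ => True)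

theorem sum_card_link {n : ℕ} (i : Fin (n + 1)) (E : Finset (Fin (n + 1) → Fin 5)) :
    ∑ u, (link i u E).card = E.card := by
  simp_rw [card_link]
  exact (card_eq_sum_card_fiberwise (fun e _ => mem_univ (e i))).symm

theorem card_symmDiff_add {α : Type*} [DecidableEq α] (A B : Finset α) :
    (A ∆ B).card + 2 * (A ∩ B).card = A.card + B.card := by
  have h1 : (A ∆ B).card = (A \ B).card + (B \ A).card := by
    rw [symmDiff_def, sup_eq_union, card_union_of_disjoint]
    exact disjoint_sdiff_sdiff
  have h2 := card_sdiff_add_card_inter A B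
  have h3 := card_sdiff_add_card_inter B A
  rw [inter_comm] at h3
  omega

theorem filter_symmDiff' {α : Type*} [DecidableEq α] (A B : Finset α) (p : α → Prop)
    [DecidablePred p] : (A ∆ B).filter p = A.filter p ∆ B.filter p := by
  ext x
  simp only [mem_filter, mem_symmDiff]
  tauto

/-- With trace `{u, v}` on class `i`, the edge count is the sum of the counts in the two links, and
the symmetric difference has the parity of that sum. -/
theorem IsOctahedral.link_symmDiff {n : ℕ} {E : Finset (Fin (n + 1) → Fin 5)}
    (hE : IsOctahedral E) (i : Fin (n + 1)) (u v : Fin 5) :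
    IsOctahedral (link i u E ∆ link i v E) := by
  intro X hX
  rcases eq_or_ne u v with rfl | huv
  · simp
  have key := hE (i.insertNth {u, v} X) (by
    intro k
    refine i.succAboveCases ?_ (fun j => ?_) k
    · simp [card_pair huv]
    · simp [hX])
  have hlink : ∀ w ∈ ({u, v} : Finset (Fin 5)),
      ((link i w E).filter (fun e => ∀ k, e k ∈ X k)).card
        = (E.filter (fun e => (∀ k, e k ∈ (i.insertNth {u, v} X : Fin (n + 1) → Finset (Fin 5)) k)
          ∧ e i = w)).card := by
    intro w hw
    rw [← card_filter_link]
    congr 1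
    refine filter_congr fun g _ => ?_
    simp only [Fin.forall_iff_succAbove i, Fin.insertNth_apply_same,
      Fin.insertNth_apply_succAbove, hw, true_and]
  have hsum : (E.filter
      (fun e => ∀ k, e k ∈ (i.insertNth {u, v} X : Fin (n + 1) → Finset (Fin 5)) k)).card
      = ((link i u E).filter (fun e => ∀ k, e k ∈ X k)).card
        + ((link i v E).filter (fun e => ∀ k, e k ∈ X k)).card := by
    rw [hlink u (by simp), hlink v (by simp), ← card_union_of_disjoint]
    · congr 1
      ext e
      simp only [mem_filter, mem_union]
      constructor
      · rintro ⟨he, h⟩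
        have := h i
        simp only [Fin.insertNth_apply_same, mem_insert, mem_singleton] at this
        tauto
      · tauto
    · rw [disjoint_filter]
      rintro e _ ⟨_, h⟩ ⟨_, h'⟩
      exact huv (h.symm.trans h')
  rw [hsum] at key
  rw [filter_symmDiff']
  have := card_symmDiff_add ((link i u E).filter (fun e => ∀ k, e k ∈ X k))
    ((link i v E).filter (fun e => ∀ k, e k ∈ X k))
  rw [Nat.even_iff] at key ⊢
  omega

theorem link_eq_empty {n : ℕ} {i : Fin (n + 1)} {w : Fin 5} {E : Finset (Fin (n + 1) → Fin 5)}
    (hw : w ∉ usedVertices E i) : link i w E = ∅ := by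
  rwa [← not_nonempty_iff_eq_empty, link_nonempty_iff]

theorem IsOctahedral.link_of_notMem {n : ℕ} {E : Finset (Fin (n + 1) → Fin 5)}
    (hE : IsOctahedral E) {i : Fin (n + 1)} {w : Fin 5} (hw : w ∉ usedVertices E i) (u : Fin 5) :
    IsOctahedral (link i u E) := by
  have h := hE.link_symmDiff i u w
  rwa [link_eq_empty hw, ← bot_eq_empty, symmDiff_bot] at h

theorem card_usedVertices_le {n : ℕ} (E : Finset (Fin n → Fin 5)) (j : Fin n) :
    (usedVertices E j).card ≤ E.card := card_image_le

/-- Without classes, parity excludes the single possible edge. Otherwise either class `0` is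
covered, which takes five edges, or an unused vertex has empty link, so that the other links are
themselves octahedral. -/
theorem IsOctahedral.five_le_card {n : ℕ} {E : Finset (Fin n → Fin 5)}
    (hE : IsOctahedral E) (hne : E.Nonempty) : 5 ≤ E.card := by
  induction n with
  | zero =>
    obtain ⟨e, he⟩ := hne
    have h := hE (fun i => i.elim0) (fun i => i.elim0)
    have : E = {e} := by
      ext x
      simp [Subsingleton.elim x e, he]
    simp [this] at h
  | succ n ih =>
    by_cases hc : usedVertices E 0 = univ
    · simpa [hc] using card_usedVertices_le E 0
    · obtain ⟨w, hw⟩ : ∃ w, w ∉ usedVertices E 0 := by simpa [eq_univ_iff_forall] using hc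
      obtain ⟨e, he⟩ := hne
      refine (ih (hE.link_of_notMem hw (e 0)) ⟨_, removeNth_mem_link he⟩).trans ?_
      rw [card_link]
      exact card_filter_le _ _

/-- An unused vertex makes every link in class `j` octahedral, so each nonempty one has at least
five edges; the links partition `E`. -/
theorem IsOctahedral.five_mul_card_usedVertices_le {n : ℕ} {E : Finset (Fin n → Fin 5)}
    (hE : IsOctahedral E) {j : Fin n} (hj : usedVertices E j ≠ univ) :
    5 * (usedVertices E j).card ≤ E.card := by
  cases n with
  | zero => exact j.elim0
  | succ n =>
    obtain ⟨w, hw⟩ : ∃ w, w ∉ usedVertices E j := by simpa [eq_univ_iff_forall] using hj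
    calc 5 * (usedVertices E j).card = ∑ _u ∈ usedVertices E j, 5 := by simp [mul_comm]
      _ ≤ ∑ u ∈ usedVertices E j, (link j u E).card := sum_le_sum fun u hu =>
          (hE.link_of_notMem hw u).five_le_card (link_nonempty_iff.2 hu)
      _ ≤ ∑ u, (link j u E).card := sum_le_sum_of_subset (subset_univ _)
      _ = E.card := sum_card_link j E

/-- An octahedral system with fewer than eight edges, all of whose pairs of covered classes force
eight edges, consists of the five edges through a fixed choice of all vertices but one. -/
theorem IsOctahedral.exists_umbrella {n : ℕ} {E : Finset (Fin n → Fin 5)}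
    (hE : IsOctahedral E) (hne : E.Nonempty) (hcard : E.card < 8)
    (h : ∀ C : Finset (Fin n), (∀ j ∈ C, usedVertices E j = univ) → C.card ≤ 5 →
      3 * C.card + 2 ≤ E.card) :
    E.card = 5 ∧ ∃ j, ∀ e ∈ E, ∀ e' ∈ E, ∀ k ≠ j, e k = e' k := by
  have h5 := hE.five_le_card hne
  have hsingle : ∀ k, usedVertices E k ≠ univ → ∀ e ∈ E, ∀ e' ∈ E, e k = e' k := by
    intro k hk e he e' he'
    have := hE.five_mul_card_usedVertices_le hk
    have h1 : (usedVertices E k).card ≤ 1 := by omega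
    exact card_le_one.1 h1 _ (mem_usedVertices.2 ⟨e, he, rfl⟩) _ (mem_usedVertices.2 ⟨e', he', rfl⟩)
  have hex : ∃ j, usedVertices E j = univ := by
    by_contra! hcon
    have : E.card ≤ 1 := card_le_one.2 fun e he e' he' =>
      funext fun k => hsingle k (hcon k) e he e' he'
    omega
  obtain ⟨j, hj⟩ := hex
  have hoff : ∀ e ∈ E, ∀ e' ∈ E, ∀ k ≠ j, e k = e' k := by
    intro e he e' he' k hk
    refine hsingle k (fun hku => ?_) e he e' he'
    -- A second covered class would force `3 * 2 + 2 = 8` edges.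
    have := h {k, j} (by simp [hj, hku]) (by rw [card_pair hk]; norm_num)
    rw [card_pair hk] at this
    omega
  refine ⟨le_antisymm ?_ h5, j, hoff⟩
  have : (usedVertices E j).card = E.card := card_image_of_injOn fun e he e' he' hee => by
    funext k
    by_cases hk : k = j
    · subst hk; exact hee
    · exact hoff e he e' he' k hk
  rw [← this]
  exact (card_le_univ _).trans (by simp)

/-! ### Covering classes by several systems -/

section Counting

variable {n : ℕ} {L : Finset (Fin n → Fin 5)} {F : Fin 5 → Finset (Fin n → Fin 5)}
  {M : Finset (Fin 5)}

/-- A class covered by `L` and the sets `F v` is covered by one of the `F v` alone, or these have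
many edges. -/
theorem exists_covered_or_le_sum (hF : ∀ v ∈ M, IsOctahedral (F v)) {j : Fin n}
    (hj : ∀ u, u ∈ usedVertices L j ∨ ∃ v ∈ M, u ∈ usedVertices (F v) j) :
    (∃ v ∈ M, usedVertices (F v) j = univ) ∨
      25 ≤ ∑ v ∈ M, (F v).card + 5 * (usedVertices L j).card := by
  by_contra! hcon
  obtain ⟨h1, h2⟩ := hcon
  have hcov : (univ : Finset (Fin 5)) ⊆ usedVertices L j ∪ M.biUnion fun v => usedVertices (F v) j := by
    intro u _
    simpa using hj u
  have h3 := card_le_card hcov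
  have h4 := card_union_le (usedVertices L j) (M.biUnion fun v => usedVertices (F v) j)
  have h5 : (M.biUnion fun v => usedVertices (F v) j).card ≤ ∑ v ∈ M, (usedVertices (F v) j).card :=
    card_biUnion_le
  have h6 : ∑ v ∈ M, 5 * (usedVertices (F v) j).card ≤ ∑ v ∈ M, (F v).card :=
    sum_le_sum fun v hv => (hF v hv).five_mul_card_usedVertices_le (h1 v hv)
  rw [← mul_sum] at h6
  simp only [card_univ, Fintype.card_fin] at h3
  omega

/-- Each class is charged to a system covering it, while every member of `M` still contributes its
constant 2. Here `hF` is the induction hypothesis. -/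
theorem le_sum_of_forall_exists_covered {C : Finset (Fin n)} (hC : C.card ≤ 5)
    (hF : ∀ v ∈ M, ∀ D : Finset (Fin n), (∀ j ∈ D, usedVertices (F v) j = univ) → D.card ≤ 5 →
      3 * D.card + 2 ≤ (F v).card)
    (h : ∀ j ∈ C, ∃ v ∈ M, usedVertices (F v) j = univ) :
    3 * C.card + 2 * M.card ≤ ∑ v ∈ M, (F v).card := by
  have h1 : C.card ≤ ∑ v ∈ M, (C.filter fun j => usedVertices (F v) j = univ).card := by
    refine (card_le_card (t := M.biUnion fun v => C.filter fun j => usedVertices (F v) j = univ)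
      fun j hj => ?_).trans card_biUnion_le
    obtain ⟨v, hv, hvj⟩ := h j hj
    simp only [mem_biUnion, mem_filter]
    exact ⟨v, hv, hj, hvj⟩
  have h2 : ∑ v ∈ M, (3 * (C.filter fun j => usedVertices (F v) j = univ).card + 2)
      ≤ ∑ v ∈ M, (F v).card :=
    sum_le_sum fun v hv => hF v hv _ (fun j hj => (mem_filter.1 hj).2)
      ((card_filter_le _ _).trans hC)
  rw [sum_add_distrib, ← mul_sum, sum_const, smul_eq_mul] at h2
  omega

end Counting

/-! ### The edge bound by induction on the classes -/

/-- An octahedral system that covers `c ≤ 5` classes has at least `3 c + 2` edges. -/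
theorem IsOctahedral.three_mul_card_add_two_le {n : ℕ} {E : Finset (Fin n → Fin 5)}
    (hE : IsOctahedral E) (hne : E.Nonempty) {C : Finset (Fin n)}
    (hC : ∀ j ∈ C, usedVertices E j = univ) (hC5 : C.card ≤ 5) : 3 * C.card + 2 ≤ E.card := by
  induction n with
  | zero =>
    have h0 : C = ∅ := eq_empty_of_isEmpty C
    have := hE.five_le_card hne
    simp only [h0, card_empty]
    omega
  | succ n ih =>
  rcases C.eq_empty_or_nonempty with rfl | ⟨i, hi⟩
  · have := hE.five_le_card hne
    simp only [card_empty]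
    omega
  by_contra! hlt
  obtain ⟨b, -, hb⟩ := exists_min_image univ (fun u => (link i u E).card) univ_nonempty
  replace hb : ∀ v, (link i b E).card ≤ (link i v E).card := fun v => hb v (mem_univ v)
  set L := link i b E with hL
  set F : Fin 5 → Finset (Fin n → Fin 5) := fun v => L ∆ link i v E with hFdef
  set M : Finset (Fin 5) := univ.filter fun v => (F v).Nonempty with hM
  set C' : Finset (Fin n) := univ.filter fun j => i.succAbove j ∈ C with hC'
  have hFo : ∀ v, IsOctahedral (F v) := fun v => hE.link_symmDiff i b v
  have hFne : ∀ v ∈ M, (F v).Nonempty := fun v hv => (mem_filter.1 hv).2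
  have hbM : b ∉ M := by simp [hM, hFdef, hL]
  have hM4 : M.card ≤ 4 := by
    have : M.card < 5 := by
      simpa using card_lt_card (ssubset_univ_iff.2 fun h : M = univ => hbM (h ▸ mem_univ b))
    omega
  have hlinkM : ∀ v ∉ M, link i v E = L := by
    intro v hv
    have : F v = ∅ := by simpa [hM, not_nonempty_iff_eq_empty] using hv
    exact (symmDiff_eq_bot.1 this).symm
  have hC'card : C'.card + 1 = C.card := by
    rw [← card_image_of_injective C' (Fin.succAbove_right_injective (p := i)), ← card_erase_add_one hi]
    congr 2
    ext k
    simp only [mem_image, mem_erase, hC', mem_filter, mem_univ, true_and]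
    constructor
    · rintro ⟨j, hj, rfl⟩
      exact ⟨Fin.succAbove_ne i j, hj⟩
    · rintro ⟨hk, hkC⟩
      obtain ⟨j, rfl⟩ := Fin.exists_succAbove_eq hk
      exact ⟨j, hkC, rfl⟩
  have hLpos : 0 < L.card := by
    rw [card_pos, hL, link_nonempty_iff, hC i hi]
    exact mem_univ b
  have hcov : ∀ j ∈ C', ∀ u, u ∈ usedVertices L j ∨ ∃ v ∈ M, u ∈ usedVertices (F v) j := by
    intro j hj u
    have hu : u ∈ usedVertices E (i.succAbove j) := by
      rw [hC _ (mem_filter.1 hj).2]; exact mem_univ u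
    obtain ⟨e, he, rfl⟩ := mem_usedVertices.1 hu
    have hel := removeNth_mem_link (i := i) he
    by_cases heL : i.removeNth e ∈ L
    · exact Or.inl (mem_usedVertices.2 ⟨_, heL, rfl⟩)
    · have hmem : i.removeNth e ∈ F (e i) := mem_symmDiff.2 (Or.inr ⟨hel, heL⟩)
      exact Or.inr ⟨e i, mem_filter.2 ⟨mem_univ _, ⟨_, hmem⟩⟩, mem_usedVertices.2 ⟨_, hmem, rfl⟩⟩
  have hIH : ∀ v ∈ M, ∀ D : Finset (Fin n), (∀ j ∈ D, usedVertices (F v) j = univ) → D.card ≤ 5 →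
      3 * D.card + 2 ≤ (F v).card := fun v hv D hD hD5 => ih (hFo v) (hFne v hv) hD hD5
  have hEcard : E.card = (5 - M.card) * L.card + ∑ v ∈ M, (link i v E).card := by
    rw [← sum_card_link i E, ← sum_add_sum_compl M, add_comm]
    congr 1
    rw [sum_congr rfl fun v hv => congrArg card (hlinkM v (mem_compl.1 hv)), sum_const, card_compl]
    simp
  have hFcard : ∀ v, (F v).card + 2 * (L ∩ link i v E).card = L.card + (link i v E).card :=
    fun v => card_symmDiff_add _ _
  have hinter : ∀ v, (L ∩ link i v E).card ≤ L.card := fun v => card_le_card inter_subset_left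
  have hsumF : ∑ v ∈ M, (F v).card ≤ M.card * L.card + ∑ v ∈ M, (link i v E).card := by
    rw [← smul_eq_mul, ← sum_const, ← sum_add_distrib]
    exact sum_le_sum fun v _ => by have := hFcard v; omega
  have hF5 : ∀ v ∈ M, 5 ≤ (F v).card := fun v hv => (hFo v).five_le_card (hFne v hv)
  -- either all classes are covered by the differences of links, or these are large
  have hS : 3 * C'.card + 2 * M.card ≤ ∑ v ∈ M, (F v).card ∨
      25 ≤ ∑ v ∈ M, (F v).card + 5 * L.card := by
    by_cases hall : ∀ j ∈ C', ∃ v ∈ M, usedVertices (F v) j = univ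
    · exact Or.inl (le_sum_of_forall_exists_covered (by omega) hIH hall)
    · push Not at hall
      obtain ⟨j, hj, hjM⟩ := hall
      right
      rcases exists_covered_or_le_sum (fun v _ => hFo v) (hcov j hj) with ⟨v, hv, h⟩ | h
      · exact absurd h (hjM v hv)
      · have := card_usedVertices_le L j
        omega
  have hmin : M.card * L.card ≤ ∑ v ∈ M, (link i v E).card := by
    rw [← smul_eq_mul, ← sum_const]
    exact sum_le_sum fun v _ => hb v
  -- By assumption `E.card ≤ 3 * C'.card + 4 ≤ 16`, and every link has at least `L.card` edges, so
  -- `4 ≤ L.card` is impossible outright.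
  obtain hL1 | hL2 | hL3 | hL4 : L.card = 1 ∨ L.card = 2 ∨ L.card = 3 ∨ 4 ≤ L.card := by omega
  · rw [hL1] at hEcard hsumF hS
    omega
  · rw [hL2] at hEcard hsumF hS hmin
    -- For at most two differences, both alternatives in `hS` exceed the assumed bound.
    have hM3 : 3 ≤ M.card := by omega
    have hdeg3 : ∀ v ∈ M, 3 ≤ (link i v E).card := by
      intro v hv
      have := hF5 v hv
      have := hFcard v
      have := hb v
      by_contra
      omega
    -- Degree four makes the size of `F v` even, hence six, whereas a system with fewer than eight
    -- edges has exactly five.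
    have hdeg4 : ∀ v ∈ M, (link i v E).card ≠ 4 := by
      intro v hv h4
      have h1 := hF5 v hv
      have h2 := hFcard v
      have := ((hFo v).exists_umbrella (hFne v hv) (by omega) (hIH v hv)).1
      omega
    obtain ⟨w, hw, hwmax⟩ := exists_max_image M (fun v => (link i v E).card)
      (card_pos.1 (by omega))
    have hEw : E.card = (5 - M.card) * 2 + ((link i w E).card
        + ∑ v ∈ M.erase w, (link i v E).card) := by
      rw [hEcard, add_sum_erase M (fun v => (link i v E).card) hw]
    have hMw : (M.erase w).card + 1 = M.card := card_erase_add_one hw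
    -- Two vertices of degree at least five would give `2 (5 - m) + 10 + 3 (m - 2) = 14 + m ≥ 17`
    -- edges, where `m` is the size of `M`.
    have hdeg : ∀ v ∈ M, v ≠ w → (link i v E).card = 3 := by
      intro v hv hvw
      by_contra hv3
      have h3 := hdeg3 v hv
      have h4 := hdeg4 v hv
      have hmx := hwmax v hv
      have hvm : v ∈ M.erase w := mem_erase.2 ⟨hvw, hv⟩
      rw [← add_sum_erase (M.erase w) (fun v => (link i v E).card) hvm] at hEw
      have hle : ((M.erase w).erase v).card • 3
          ≤ ∑ v ∈ (M.erase w).erase v, (link i v E).card :=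
        card_nsmul_le_sum _ _ _ fun x hx => hdeg3 x (mem_of_mem_erase (mem_of_mem_erase hx))
      have hMv : ((M.erase w).erase v).card + 1 = (M.erase w).card := card_erase_add_one hvm
      rw [smul_eq_mul] at hle
      omega
    have hle : ∑ v ∈ M.erase w, (link i v E).card = (M.erase w).card * 3 := by
      rw [sum_congr rfl fun v hv => hdeg v (mem_of_mem_erase hv) (ne_of_mem_erase hv), sum_const,
        smul_eq_mul]
    obtain ⟨p, q, hpq, hLpq⟩ := card_eq_two.1 hL2
    obtain ⟨k, hk⟩ : ∃ k, p k ≠ q k := by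
      by_contra! h
      exact hpq (funext h)
    -- Degree three forces the link to be disjoint from `L`, so `p` and `q` both lie in `F v`; as
    -- they differ in class `k`, this is the free class of the umbrella.
    have hline : ∀ v ∈ M, v ≠ w → ∀ e ∈ F v, ∀ j ≠ k, e j = p j := by
      intro v hv hvw e he j hj
      have hd := hdeg v hv hvw
      have hc := hFcard v
      have h5 := hF5 v hv
      obtain ⟨-, l, hl⟩ := (hFo v).exists_umbrella (hFne v hv) (by omega) (hIH v hv)
      have hdisj : L ∩ link i v E = ∅ := card_eq_zero.1 (by omega)
      have hsub : ∀ x ∈ L, x ∈ F v := fun x hx => mem_symmDiff.2 (Or.inl ⟨hx, fun hx' => by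
        have : x ∈ L ∩ link i v E := mem_inter.2 ⟨hx, hx'⟩
        rw [hdisj] at this
        exact notMem_empty _ this⟩)
      have hp := hsub p (by simp [hLpq])
      have hq := hsub q (by simp [hLpq])
      have hkl : k = l := by
        by_contra hkl
        exact hk (hl p hp q hq k hkl)
      exact hl e he p hp j (hkl ▸ hj)
    have hpqj : ∀ j ≠ k, q j = p j := by
      intro j hj
      obtain ⟨v, hv⟩ : (M.erase w).Nonempty := card_pos.1 (by omega)
      have hvM := mem_of_mem_erase hv
      have hvw := ne_of_mem_erase hv
      have hd := hdeg v hvM hvw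
      have hc := hFcard v
      have h5 := hF5 v hvM
      have hdisj : L ∩ link i v E = ∅ := card_eq_zero.1 (by omega)
      refine hline v hvM hvw q (mem_symmDiff.2 (Or.inl ⟨by simp [hLpq], fun hx' => ?_⟩)) j hj
      have : q ∈ L ∩ link i v E := mem_inter.2 ⟨by simp [hLpq], hx'⟩
      rw [hdisj] at this
      exact notMem_empty _ this
    have hFw : (F w).card ≤ 8 := by
      have := hFcard w
      omega
    -- Outside class `k`, `L` and all `F v` with `v ≠ w` see only the vertices of `p`. So `F w`
    -- alone reaches the other four vertices of class `j`; if it missed the fifth, it would have at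
    -- least 20 edges.
    have hcovw : ∀ j ∈ C'.erase k, usedVertices (F w) j = univ := by
      intro j hj
      have hjk := ne_of_mem_erase hj
      by_contra hne'
      have h5 := (hFo w).five_mul_card_usedVertices_le hne'
      have hsub : (univ : Finset (Fin 5)).erase (p j) ⊆ usedVertices (F w) j := by
        intro u hu
        have hup := ne_of_mem_erase hu
        rcases hcov j (mem_of_mem_erase hj) u with h | ⟨v, hv, h⟩
        · obtain ⟨e, he, rfl⟩ := mem_usedVertices.1 h
          rw [hLpq, mem_insert, mem_singleton] at he
          rcases he with rfl | rfl
          · exact absurd rfl hup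
          · exact absurd (hpqj j hjk) hup
        · by_cases hvw : v = w
          · exact hvw ▸ h
          · obtain ⟨e, he, rfl⟩ := mem_usedVertices.1 h
            exact absurd (hline v hv hvw e he j hjk) hup
      have := card_le_card hsub
      rw [card_erase_of_mem (mem_univ _), card_univ, Fintype.card_fin] at this
      omega
    have h1 := hIH w hw _ hcovw ((card_le_card (erase_subset _ _)).trans (by omega))
    have h2 := pred_card_le_card_erase (s := C') (a := k)
    have := hFcard w
    omega
  · rw [hL3] at hEcard hsumF hS hmin
    -- Degree three would again make the size of `F v` even, hence six.
    have hdeg4 : ∀ v ∈ M, 4 ≤ (link i v E).card := by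
      intro v hv
      by_contra hlt4
      have h1 := hF5 v hv
      have h2 := hFcard v
      have h3 := hb v
      have := ((hFo v).exists_umbrella (hFne v hv) (by omega) (hIH v hv)).1
      omega
    have hle : M.card • 4 ≤ ∑ v ∈ M, (link i v E).card := card_nsmul_le_sum _ _ _ hdeg4
    rw [smul_eq_mul] at hle
    omega
  · have h1 : (5 - M.card) * 4 ≤ (5 - M.card) * L.card := Nat.mul_le_mul_left _ hL4
    have h2 : M.card * 4 ≤ M.card * L.card := Nat.mul_le_mul_left _ hL4
    omega

theorem IsOctahedral.seventeen_le_card {E : Finset (Fin 5 → Fin 5)} (hE : IsOctahedral E)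
    (hcov : ∀ i v, ∃ e ∈ E, e i = v) : 17 ≤ E.card := by
  obtain ⟨e, he, -⟩ := hcov 0 0
  have := hE.three_mul_card_add_two_le ⟨e, he⟩ (C := univ)
    (fun j _ => eq_univ_of_forall fun u => mem_usedVertices.2 (hcov j u)) (by simp)
  simpa using this

/-! ### Generic vectors, dependencies and ray crossings -/

/-- Any `d` vectors with distinct labels are linearly independent. -/
def LinearlyGeneric {d : ℕ} {Λ : Type*} (v : Λ → EuclideanSpace ℝ (Fin d)) : Prop :=
  ∀ f : Fin d → Λ, Function.Injective f → LinearIndependent ℝ (fun k => v (f k))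

theorem LinearlyGeneric.comp {d : ℕ} {Λ Λ' : Type*} {v : Λ → EuclideanSpace ℝ (Fin d)}
    (hv : LinearlyGeneric v) {g : Λ' → Λ} (hg : Function.Injective g) :
    LinearlyGeneric (fun a => v (g a)) :=
  fun f hf => hv (fun k => g (f k)) (hg.comp hf)

theorem mem_convexHull_range_iff {E ι : Type*} [AddCommGroup E] [Module ℝ E] [Fintype ι]
    (s : ι → E) (x : E) :
    x ∈ convexHull ℝ (Set.range s) ↔ ∃ w ∈ stdSimplex ℝ ι, ∑ i, w i • s i = x := by
  classical
  have h : Set.range s = Fintype.linearCombination ℝ s '' Set.range fun i => Pi.single i (1 : ℝ) := by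
    rw [← Set.range_comp]
    congr 1
    funext i
    simp [Fintype.linearCombination_apply_single]
  rw [h, ← LinearMap.image_convexHull, convexHull_rangle_single_eq_stdSimplex]
  rfl

theorem zero_mem_convexHull_range_iff {E ι : Type*} [AddCommGroup E] [Module ℝ E] [Fintype ι]
    (s : ι → E) :
    (0 : E) ∈ convexHull ℝ (Set.range s) ↔
      ∃ w : ι → ℝ, (∀ i, 0 ≤ w i) ∧ (∃ i, w i ≠ 0) ∧ ∑ i, w i • s i = 0 := by
  rw [mem_convexHull_range_iff]
  constructor
  · rintro ⟨w, hw, h⟩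
    refine ⟨w, hw.1, ?_, h⟩
    by_contra! h0
    have := hw.2
    simp [h0] at this
  · rintro ⟨w, hw, ⟨i, hi⟩, h⟩
    have hpos : 0 < ∑ i, w i :=
      sum_pos' (fun i _ => hw i) ⟨i, mem_univ i, lt_of_le_of_ne (hw i) (Ne.symm hi)⟩
    refine ⟨fun i => (∑ i, w i)⁻¹ * w i, ⟨fun i => mul_nonneg (inv_nonneg.2 hpos.le) (hw i), ?_⟩, ?_⟩
    · rw [← mul_sum, inv_mul_cancel₀ hpos.ne']
    · simp_rw [mul_smul]
      rw [← smul_sum, h, smul_zero]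

/-- An independent family of full size detects zero. -/
theorem LinearIndependent.eq_zero_of_forall_inner_eq_zero {d : ℕ}
    {b : Fin d → EuclideanSpace ℝ (Fin d)} (hb : LinearIndependent ℝ b)
    {u : EuclideanSpace ℝ (Fin d)} (h : ∀ k, inner ℝ (b k) u = 0) : u = 0 := by
  have hu : u ∈ Submodule.span ℝ (Set.range b) := by
    rw [hb.span_eq_top_of_card_eq_finrank' (by simp)]
    exact Submodule.mem_top
  obtain ⟨c, hc⟩ := (Submodule.mem_span_range_iff_exists_fun ℝ).1 hu
  rw [← inner_self_eq_zero (𝕜 := ℝ)]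
  nth_rewrite 1 [← hc]
  simp [sum_inner, inner_smul_left, h]

section Dependency

variable {d : ℕ} {s : Fin (d + 1) → EuclideanSpace ℝ (Fin d)}

/-- The other `d` vectors are independent. Hence the dependency of `d + 1` generic vectors is unique
up to a scalar. -/
theorem LinearlyGeneric.eq_zero_of_apply_eq_zero (hs : LinearlyGeneric s) {w : Fin (d + 1) → ℝ}
    (hw : ∑ k, w k • s k = 0) {i : Fin (d + 1)} (hi : w i = 0) : w = 0 := by
  rw [Fin.sum_univ_succAbove _ i, hi, zero_smul, zero_add] at hw
  have := Fintype.linearIndependent_iff.1 (hs i.succAbove Fin.succAbove_right_injective) _ hw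
  funext k
  exact i.succAboveCases hi this k

theorem LinearlyGeneric.exists_dependency (hs : LinearlyGeneric s) :
    ∃ c : Fin (d + 1) → ℝ, ∑ k, c k • s k = 0 ∧ ∀ k, c k ≠ 0 := by
  have hdep : ¬ LinearIndependent ℝ s := fun h => by
    have := h.fintype_card_le_finrank
    simp at this
  obtain ⟨c, hc, i, hi⟩ := Fintype.not_linearIndependent_iff.1 hdep
  refine ⟨c, hc, fun k hk => hi ?_⟩
  rw [hs.eq_zero_of_apply_eq_zero hc hk]
  rfl

theorem LinearlyGeneric.zero_mem_convexHull_iff (hs : LinearlyGeneric s) {c : Fin (d + 1) → ℝ}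
    (hc : ∑ k, c k • s k = 0) (hc0 : ∀ k, c k ≠ 0) :
    (0 : EuclideanSpace ℝ (Fin d)) ∈ convexHull ℝ (Set.range s) ↔
      (∀ k, 0 < c k) ∨ ∀ k, ¬ 0 < c k := by
  rw [zero_mem_convexHull_range_iff]
  constructor
  · rintro ⟨w, hw, ⟨i, hi⟩, hsum⟩
    have hprop : (fun k => w k - w 0 / c 0 * c k) = 0 := by
      refine hs.eq_zero_of_apply_eq_zero (i := 0) ?_ (by simp [hc0])
      simp_rw [sub_smul, mul_smul]
      rw [sum_sub_distrib, ← smul_sum, hc, hsum, smul_zero, sub_zero]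
    have hw' : ∀ k, w k = w 0 / c 0 * c k := fun k => by
      have := congrFun hprop k
      simp only [Pi.zero_apply] at this
      linarith
    have ht : w 0 / c 0 ≠ 0 := fun h => hi (by rw [hw' i, h, zero_mul])
    rcases lt_or_gt_of_ne ht with h | h
    · right
      intro k hk
      have h1 := hw k
      rw [hw' k] at h1
      exact absurd (mul_neg_of_neg_of_pos h hk) (not_lt.2 h1)
    · left
      intro k
      have h1 := hw k
      rw [hw' k] at h1
      exact lt_of_le_of_ne (nonneg_of_mul_nonneg_right h1 h) (hc0 k).symm
  · rintro (h | h)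
    · exact ⟨c, fun k => (h k).le, ⟨0, hc0 0⟩, hc⟩
    · exact ⟨fun k => - c k, fun k => neg_nonneg.2 (not_lt.1 (h k)), ⟨0, neg_ne_zero.2 (hc0 0)⟩,
        by simp [hc]⟩

open Classical in
/-- A line is entered and left by an intersection of half-lines exactly at two points, or never,
unless all half-lines have the same direction. -/
theorem odd_card_filter_extremal_iff {n : ℕ} {t : Fin (n + 1) → ℝ} (ht : Function.Injective t)
    (P : Fin (n + 1) → Prop) :
    Odd (univ.filter fun i => (∀ k, P k → t k ≤ t i) ∧ ∀ k, ¬ P k → t i ≤ t k).card ↔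
      (∀ k, P k) ∨ ∀ k, ¬ P k := by
  by_cases h1 : ∀ k, P k
  · obtain ⟨m, -, hm⟩ := exists_max_image univ t univ_nonempty
    have : (univ.filter fun i => (∀ k, P k → t k ≤ t i) ∧ ∀ k, ¬ P k → t i ≤ t k) = {m} := by
      ext i
      simp only [mem_filter, mem_univ, true_and, mem_singleton]
      constructor
      · rintro ⟨h, -⟩
        exact ht (le_antisymm (hm i (mem_univ i)) (h m (h1 m)))
      · rintro rfl
        exact ⟨fun k _ => hm k (mem_univ k), fun k hk => absurd (h1 k) hk⟩
    rw [this]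
    simp [h1]
  by_cases h2 : ∀ k, ¬ P k
  · obtain ⟨m, -, hm⟩ := exists_min_image univ t univ_nonempty
    have : (univ.filter fun i => (∀ k, P k → t k ≤ t i) ∧ ∀ k, ¬ P k → t i ≤ t k) = {m} := by
      ext i
      simp only [mem_filter, mem_univ, true_and, mem_singleton]
      constructor
      · rintro ⟨-, h⟩
        exact ht (le_antisymm (h m (h2 m)) (hm i (mem_univ i)))
      · rintro rfl
        exact ⟨fun k hk => absurd hk (h2 k), fun k _ => hm k (mem_univ k)⟩
    rw [this]
    simp [h2]
  simp only [h1, h2, or_self, iff_false, Nat.not_odd_iff_even]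
  push Not at h1 h2
  obtain ⟨q₀, hq₀⟩ := h1
  obtain ⟨p₀, hp₀⟩ := h2
  obtain ⟨p, hp, hpm⟩ := exists_max_image (univ.filter P) t ⟨p₀, by simpa using hp₀⟩
  obtain ⟨q, hq, hqm⟩ := exists_min_image (univ.filter fun k => ¬ P k) t ⟨q₀, by simpa using hq₀⟩
  simp only [mem_filter, mem_univ, true_and] at hp hpm hq hqm
  have hpq : p ≠ q := fun h => hq (h ▸ hp)
  -- The admissible parameters form the interval from `t p` to `t q`; its two endpoints are counted,
  -- unless it is empty.
  by_cases hlt : t p ≤ t q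
  · have : (univ.filter fun i => (∀ k, P k → t k ≤ t i) ∧ ∀ k, ¬ P k → t i ≤ t k) = {p, q} := by
      ext i
      simp only [mem_filter, mem_univ, true_and, mem_insert, mem_singleton]
      constructor
      · rintro ⟨h, h'⟩
        by_cases hi : P i
        · exact Or.inl (ht (le_antisymm (hpm i hi) (h p hp)))
        · exact Or.inr (ht (le_antisymm (h' q hq) (hqm i hi)))
      · rintro (rfl | rfl)
        · exact ⟨hpm, fun k hk => hlt.trans (hqm k hk)⟩
        · exact ⟨fun k hk => (hpm k hk).trans hlt, hqm⟩
    rw [this, card_pair hpq]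
    exact even_two
  · have : (univ.filter fun i => (∀ k, P k → t k ≤ t i) ∧ ∀ k, ¬ P k → t i ≤ t k) = ∅ := by
      refine filter_eq_empty_iff.2 fun i _ => ?_
      rintro ⟨h, h'⟩
      exact hlt ((h p hp).trans (h' q hq))
    simp [this]

open Classical in
/-- A generic ray from the origin crosses an odd number of facets of a simplex exactly when the
origin lies in the simplex. -/
theorem LinearlyGeneric.odd_card_facets_iff (hs : LinearlyGeneric s)
    {r : EuclideanSpace ℝ (Fin d)}
    (hr : ∀ w : Fin (d + 1) → ℝ, ∑ k, w k • s k = r → ∀ i k, w i = 0 → w k = 0 → i = k) :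
    Odd (univ.filter fun i =>
      ∃ w : Fin (d + 1) → ℝ, (∀ k, 0 ≤ w k) ∧ w i = 0 ∧ ∑ k, w k • s k = r).card ↔
      (0 : EuclideanSpace ℝ (Fin d)) ∈ convexHull ℝ (Set.range s) := by
  obtain ⟨c, hc, hc0⟩ := hs.exists_dependency
  obtain ⟨a, ha⟩ : ∃ a : Fin (d + 1) → ℝ, ∑ k, a k • s k = r := by
    have hli := hs (Fin.succAbove 0) Fin.succAbove_right_injective
    have htop := hli.span_eq_top_of_card_eq_finrank' (by simp)
    obtain ⟨b, hb⟩ := (Submodule.mem_span_range_iff_exists_fun ℝ).1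
      (htop ▸ Submodule.mem_top (x := r))
    exact ⟨Fin.cons 0 b, by simpa [Fin.sum_univ_succ] using hb⟩
  -- The representations of `r` are `a + τ c`, and `t k` is the `τ` at which coefficient `k`
  -- vanishes. Nonnegativity of that coefficient bounds `τ` by `t k` from below or above, according
  -- to the sign of `c k`.
  set t : Fin (d + 1) → ℝ := fun k => - a k / c k with htdef
  have hat : ∀ τ : ℝ, ∑ k, (a k + τ * c k) • s k = r := by
    intro τ
    simp_rw [add_smul, mul_smul]
    rw [sum_add_distrib, ← smul_sum, hc, ha, smul_zero, add_zero]
  have htk : ∀ k, a k + t k * c k = 0 := by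
    intro k
    simp only [htdef]
    have := hc0 k
    field_simp
    ring
  have htinj : Function.Injective t := by
    intro i k hik
    exact hr _ (hat (t i)) i k (htk i) (by rw [hik]; exact htk k)
  rw [hs.zero_mem_convexHull_iff hc hc0, ← odd_card_filter_extremal_iff htinj]
  refine iff_of_eq (congrArg (fun A : Finset (Fin (d + 1)) => Odd A.card) (filter_congr fun i _ => ?_))
  have hsign : ∀ k, a k + t i * c k = (t i - t k) * c k := fun k => by
    linear_combination htk k
  constructor
  · rintro ⟨w, hw, hwi, hwr⟩
    have hdiff : (fun k => w k - (a k + t i * c k)) = 0 := by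
      refine hs.eq_zero_of_apply_eq_zero (i := i) ?_ (by rw [hwi, htk]; simp)
      simp_rw [sub_smul]
      rw [sum_sub_distrib, hat, hwr, sub_self]
    have hnn : ∀ k, 0 ≤ (t i - t k) * c k := fun k => by
      have h1 := congrFun hdiff k
      have h2 := hw k
      rw [← hsign]
      simp only [Pi.zero_apply] at h1
      linarith
    refine ⟨fun k hk => ?_, fun k hk => ?_⟩
    · exact sub_nonneg.1 (nonneg_of_mul_nonneg_left (hnn k) hk)
    · have hneg : c k < 0 := lt_of_le_of_ne (not_lt.1 hk) (hc0 k)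
      have := nonpos_of_mul_nonneg_left (hnn k) hneg
      linarith
  · rintro ⟨h1, h2⟩
    refine ⟨fun k => a k + t i * c k, fun k => ?_, htk i, hat _⟩
    beta_reduce
    rw [hsign]
    by_cases hk : 0 < c k
    · exact mul_nonneg (sub_nonneg.2 (h1 k hk)) hk.le
    · exact mul_nonneg_of_nonpos_of_nonpos (sub_nonpos.2 (h2 k hk)) (not_lt.1 hk)

end Dependency

/-! ### Conic colourful Carathéodory -/

section Cone

variable {d m : ℕ}

/-- The cone spanned by finitely many vectors. -/
def coneHull {ι E : Type*} [Fintype ι] [AddCommGroup E] [Module ℝ E] (s : ι → E) : Set E :=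
  Fintype.linearCombination ℝ s '' Set.Ici 0

theorem mem_coneHull {ι E : Type*} [Fintype ι] [AddCommGroup E] [Module ℝ E] {s : ι → E} {z : E} :
    z ∈ coneHull s ↔ ∃ w : ι → ℝ, (∀ k, 0 ≤ w k) ∧ ∑ k, w k • s k = z := by
  simp [coneHull, Pi.le_def, Fintype.linearCombination_apply]

/-- The cone is closed, being the image of the closed orthant under an injective linear map. -/
theorem exists_nearest_mem_coneHull {s : Fin d → EuclideanSpace ℝ (Fin d)}
    (hs : LinearIndependent ℝ s) (a : EuclideanSpace ℝ (Fin d)) :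
    ∃ z ∈ coneHull s, ‖a - z‖ = ⨅ w : coneHull s, ‖a - w‖ := by
  refine exists_norm_eq_iInf_of_complete_convex ⟨0, mem_coneHull.2 ⟨0, by simp, by simp⟩⟩
    (IsClosed.isComplete ?_) ((convex_Ici 0).linear_image _) a
  refine (LinearMap.isClosedEmbedding_of_injective ?_).isClosedMap _ isClosed_Ici
  refine LinearMap.ker_eq_bot'.2 fun w hw => funext ?_
  exact Fintype.linearIndependent_iff.1 hs w (by simpa [Fintype.linearCombination_apply] using hw)

/-- The conic colourful Carathéodory theorem, for colours each of which meets every open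
half-space. -/
theorem exists_mem_coneHull_transversal [NeZero m] {y : Fin d → Fin m → EuclideanSpace ℝ (Fin d)}
    (hind : ∀ c : Fin d → Fin m, LinearIndependent ℝ (fun k => y k (c k)))
    (hpos : ∀ k, ∀ v : EuclideanSpace ℝ (Fin d), v ≠ 0 → ∃ j, 0 < inner ℝ v (y k j))
    (a : EuclideanSpace ℝ (Fin d)) :
    ∃ c : Fin d → Fin m, a ∈ coneHull (fun k => y k (c k)) := by
  choose z hz hzmin using fun c => exists_nearest_mem_coneHull (hind c) a
  obtain ⟨c, -, hc⟩ := exists_min_image univ (fun c => ‖a - z c‖) (univ_nonempty)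
  refine ⟨c, ?_⟩
  by_contra hac
  have hconv : ∀ c : Fin d → Fin m, Convex ℝ (coneHull fun k => y k (c k)) :=
    fun c => (convex_Ici 0).linear_image _
  have hu0 : a - z c ≠ 0 := fun h => hac (sub_eq_zero.1 h ▸ hz c)
  obtain ⟨w, hw, hwz⟩ := mem_coneHull.1 (hz c)
  have hle := (norm_eq_iInf_iff_real_inner_le_zero (hconv c) (hz c)).1 (hzmin c)
  have hadd : ∀ k, z c + y k (c k) ∈ coneHull (fun k => y k (c k)) := fun k =>
    mem_coneHull.2 ⟨w + Pi.single k 1, fun l => add_nonneg (hw l) (by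
      by_cases h : l = k
      · subst h; simp
      · simp [h]), by simp [add_smul, sum_add_distrib, hwz, Pi.single_apply]⟩
  have hyk : ∀ k, inner ℝ (a - z c) (y k (c k)) ≤ 0 := fun k => by
    simpa using hle _ (hadd k)
  have hzz : 0 ≤ inner ℝ (a - z c) (z c) := by
    have := hle 0 (mem_coneHull.2 ⟨0, by simp, by simp⟩)
    rw [zero_sub, inner_neg_right] at this
    linarith
  -- If no coefficient vanished, the residual `a - z c` would be orthogonal to all generators, hence
  -- zero.
  obtain ⟨k, hk⟩ : ∃ k, w k = 0 := by
    by_contra! hne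
    refine hu0 ((hind c).eq_zero_of_forall_inner_eq_zero fun k => ?_)
    have hsum : ∑ k, w k * inner ℝ (a - z c) (y k (c k)) = inner ℝ (a - z c) (z c) := by
      rw [← congrArg (inner ℝ (a - z c)) hwz, inner_sum]
      exact sum_congr rfl fun k _ => (inner_smul_right _ _ _).symm
    have hterm : ∀ k ∈ univ, w k * inner ℝ (a - z c) (y k (c k)) ≤ 0 := fun k _ =>
      mul_nonpos_of_nonneg_of_nonpos (hw k) (hyk k)
    have hzero := (sum_eq_zero_iff_of_nonpos hterm).1
      (le_antisymm (sum_nonpos hterm) (hsum ▸ hzz)) k (mem_univ k)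
    rw [real_inner_comm]
    exact (mul_eq_zero.1 hzero).resolve_left (hne k)
  -- Colour `k` is not used in `z c`, so its vector may be exchanged for one on the side of the
  -- residual. The new cone still contains `z c`, which minimality makes its nearest point,
  -- contradicting that positive inner product.
  obtain ⟨j, hj⟩ := hpos k _ hu0
  set c' := Function.update c k j with hc'
  have hw' : ∀ l, w l • y l (c' l) = w l • y l (c l) := by
    intro l
    by_cases h : l = k
    · subst h; simp [hk]
    · simp [hc', h]
  have hzc' : z c ∈ coneHull (fun k => y k (c' k)) :=
    mem_coneHull.2 ⟨w, hw, by rw [← hwz]; exact sum_congr rfl fun l _ => hw' l⟩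
  have hzadd : z c + y k j ∈ coneHull (fun k => y k (c' k)) :=
    mem_coneHull.2 ⟨w + Pi.single k 1, fun l => add_nonneg (hw l) (by
      by_cases h : l = k
      · subst h; simp
      · simp [h]), by
        simp_rw [Pi.add_apply, add_smul]
        rw [sum_add_distrib, sum_congr rfl fun l _ => hw' l, hwz]
        simp [Pi.single_apply, hc']⟩
  have hmin : ‖a - z c‖ = ⨅ w : coneHull (fun k => y k (c' k)), ‖a - w‖ := by
    refine le_antisymm ((hc c' (mem_univ _)).trans_eq (hzmin c')) ?_
    exact ciInf_le (f := fun w : coneHull (fun k => y k (c' k)) => ‖a - w‖)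
      ⟨0, Set.forall_mem_range.2 fun _ => norm_nonneg _⟩ ⟨z c, hzc'⟩
  have := (norm_eq_iInf_iff_real_inner_le_zero (hconv c') hzc').1 hmin _ hzadd
  rw [add_sub_cancel_left] at this
  linarith

end Cone

/-! ### The octahedral system of containing choices -/

section System

variable {d : ℕ} {x : Fin (d + 1) → Fin (d + 1) → EuclideanSpace ℝ (Fin d)}

theorem LinearlyGeneric.transversal
    (hx : LinearlyGeneric fun p : Fin (d + 1) × Fin (d + 1) => x p.1 p.2)
    (c : Fin (d + 1) → Fin (d + 1)) : LinearlyGeneric fun i => x i (c i) :=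
  hx.comp (g := fun i => (i, c i)) fun _ _ h => congrArg Prod.fst h

theorem LinearlyGeneric.colour
    (hx : LinearlyGeneric fun p : Fin (d + 1) × Fin (d + 1) => x p.1 p.2)
    (i : Fin (d + 1)) : LinearlyGeneric (x i) :=
  hx.comp (g := fun j => (i, j)) fun _ _ h => congrArg Prod.snd h

theorem LinearlyGeneric.exists_inner_pos {s : Fin (d + 1) → EuclideanSpace ℝ (Fin d)}
    (hs : LinearlyGeneric s) (hsum : ∑ j, s j = 0) {v : EuclideanSpace ℝ (Fin d)} (hv : v ≠ 0) :
    ∃ j, 0 < inner ℝ v (s j) := by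
  by_contra! hle
  have h0 : ∑ j, inner ℝ v (s j) = 0 := by rw [← inner_sum, hsum, inner_zero_right]
  have hz := (sum_eq_zero_iff_of_nonpos fun j _ => hle j).1 h0
  refine hv ((hs Fin.castSucc (Fin.castSucc_injective d)).eq_zero_of_forall_inner_eq_zero fun k => ?_)
  rw [real_inner_comm]
  exact hz _ (mem_univ _)

/-- The cone of some choice from the other `d` colours contains `- x i j`. -/
theorem LinearlyGeneric.exists_mem_convexHull_transversal
    (hx : LinearlyGeneric fun p : Fin (d + 1) × Fin (d + 1) => x p.1 p.2)
    (hsum : ∀ i, ∑ j, x i j = 0) (i j : Fin (d + 1)) :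
    ∃ c : Fin (d + 1) → Fin (d + 1), c i = j ∧
      (0 : EuclideanSpace ℝ (Fin d)) ∈ convexHull ℝ (Set.range fun k => x k (c k)) := by
  obtain ⟨c, hc⟩ := exists_mem_coneHull_transversal (y := fun k => x (i.succAbove k))
    (fun c => hx (fun k => (i.succAbove k, c k)) fun k l h =>
      Fin.succAbove_right_injective (congrArg Prod.fst h))
    (fun k v hv => (hx.colour _).exists_inner_pos (hsum _) hv) (- x i j)
  obtain ⟨w, hw, hwx⟩ := mem_coneHull.1 hc
  refine ⟨i.insertNth j c, by simp, (zero_mem_convexHull_range_iff _).2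
    ⟨i.insertNth 1 w, fun k => ?_, ⟨i, by simp⟩, ?_⟩⟩
  · refine i.succAboveCases ?_ (fun l => ?_) k
    · simp
    · simpa using hw l
  · rw [Fin.sum_univ_succAbove _ i]
    simp [hwx]

/-- A transversal with two vertices omitted spans a proper subspace, and finitely many of these do
not cover the space. -/
theorem LinearlyGeneric.exists_generic_direction
    (hx : LinearlyGeneric fun p : Fin (d + 1) × Fin (d + 1) => x p.1 p.2) :
    ∃ r : EuclideanSpace ℝ (Fin d), ∀ (c : Fin (d + 1) → Fin (d + 1)) (w : Fin (d + 1) → ℝ),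
      ∑ k, w k • x k (c k) = r → ∀ i k, w i = 0 → w k = 0 → i = k := by
  let I := {q : (Fin (d + 1) → Fin (d + 1)) × Fin (d + 1) × Fin (d + 1) // q.2.1 ≠ q.2.2}
  let W : I → Submodule ℝ (EuclideanSpace ℝ (Fin d)) := fun q =>
    (LinearMap.ker (LinearMap.proj (R := ℝ) (φ := fun _ : Fin (d + 1) => ℝ) q.1.2.1) ⊓
      LinearMap.ker (LinearMap.proj (R := ℝ) (φ := fun _ : Fin (d + 1) => ℝ) q.1.2.2)).map
      (Fintype.linearCombination ℝ fun k => x k (q.1.1 k))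
  have hW : ⋃ q, (W q : Set (EuclideanSpace ℝ (Fin d))) ≠ Set.univ := by
    intro h
    obtain ⟨⟨⟨c, i, k⟩, hik⟩, hq⟩ := Subspace.exists_eq_top_of_iUnion_eq_univ h
    have hmem : x k (c k) ∈ W ⟨⟨c, i, k⟩, hik⟩ := hq ▸ Submodule.mem_top
    obtain ⟨w, ⟨hwi, hwk⟩, hw⟩ := Submodule.mem_map.1 hmem
    simp only [LinearMap.mem_ker, LinearMap.proj_apply, SetLike.mem_coe] at hwi hwk
    have h0 := (hx.transversal c).eq_zero_of_apply_eq_zero (w := w - Pi.single k 1) (i := i)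
      (by
        rw [Fintype.linearCombination_apply] at hw
        simp [sub_smul, sum_sub_distrib, hw, Pi.single_apply])
      (by simp [hwi, show i ≠ k from hik])
    have := congrFun h0 k
    simp [hwk] at this
  obtain ⟨r, hr⟩ := (Set.ne_univ_iff_exists_notMem _).1 hW
  refine ⟨r, fun c w hw i k hi hk => ?_⟩
  by_contra hik
  refine hr (Set.mem_iUnion.2 ⟨⟨⟨c, i, k⟩, hik⟩, Submodule.mem_map.2 ⟨w, ⟨?_, ?_⟩, ?_⟩⟩)
  · simpa using hi
  · simpa using hk
  · simpa [Fintype.linearCombination_apply] using hw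

/-- A sum modulo two over transversals vanishes if the summand ignores one class. -/
theorem sum_piFinset_eq_zero_of_update {n m : ℕ} (X : Fin n → Finset (Fin m))
    (hX : ∀ i, (X i).card = 2) (i : Fin n) (g : (Fin n → Fin m) → ZMod 2)
    (hg : ∀ c j, g (Function.update c i j) = g c) : ∑ c ∈ Fintype.piFinset X, g c = 0 := by
  obtain ⟨a, b, hab, hXi⟩ := card_eq_two.1 (hX i)
  refine sum_involution (fun c _ => Function.update c i (Equiv.swap a b (c i))) ?_ ?_ ?_ ?_
  · intro c _
    rw [hg]
    exact CharTwo.add_self_eq_zero _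
  · intro c hc _ heq
    have hci := Fintype.mem_piFinset.1 hc i
    rw [hXi, mem_insert, mem_singleton] at hci
    have := congrFun heq i
    rw [Function.update_self] at this
    rcases hci with h | h <;> rw [h] at this
    · rw [Equiv.swap_apply_left] at this; exact hab this.symm
    · rw [Equiv.swap_apply_right] at this; exact hab this
  · intro c hc
    have hci := Fintype.mem_piFinset.1 hc i
    refine Fintype.mem_piFinset.2 fun k => ?_
    by_cases hk : k = i
    · subst hk
      rw [Function.update_self, hXi]
      rw [hXi, mem_insert, mem_singleton] at hci
      rcases hci with h | h <;> rw [h] <;> simp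
    · rw [Function.update_of_ne hk]
      exact Fintype.mem_piFinset.1 hc k
  · intro c _
    simp

open Classical in
/-- The choices whose simplex contains the origin. -/
noncomputable def containingChoices (x : Fin (d + 1) → Fin (d + 1) → EuclideanSpace ℝ (Fin d)) :
    Finset (Fin (d + 1) → Fin (d + 1)) :=
  univ.filter fun c => (0 : EuclideanSpace ℝ (Fin d)) ∈ convexHull ℝ (Set.range fun k => x k (c k))

theorem mem_containingChoices {c : Fin (d + 1) → Fin (d + 1)} : c ∈ containingChoices x ↔
    (0 : EuclideanSpace ℝ (Fin d)) ∈ convexHull ℝ (Set.range fun k => x k (c k)) := by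
  simp [containingChoices]

open Classical in
/-- The octahedron lemma. -/
theorem LinearlyGeneric.even_card_containingChoices
    (hx : LinearlyGeneric fun p : Fin (d + 1) × Fin (d + 1) => x p.1 p.2)
    (X : Fin (d + 1) → Finset (Fin (d + 1))) (hX : ∀ i, (X i).card = 2) :
    Even ((containingChoices x).filter fun c => ∀ i, c i ∈ X i).card := by
  obtain ⟨r, hr⟩ := hx.exists_generic_direction
  let hit : (Fin (d + 1) → Fin (d + 1)) → Fin (d + 1) → Prop := fun c i =>
    ∃ w : Fin (d + 1) → ℝ, (∀ k, 0 ≤ w k) ∧ w i = 0 ∧ ∑ k, w k • x k (c k) = r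
  have hodd : ∀ c, c ∈ containingChoices x ↔ Odd (univ.filter fun i => hit c i).card := fun c => by
    rw [mem_containingChoices]
    exact ((hx.transversal c).odd_card_facets_iff (hr c)).symm
  have hind : ∀ c, (if c ∈ containingChoices x then (1 : ZMod 2) else 0)
      = ∑ i, if hit c i then 1 else 0 := by
    intro c
    rw [sum_boole]
    split_ifs with h
    · exact ((ZMod.natCast_eq_one_iff_odd).2 ((hodd c).1 h)).symm
    · rw [hodd, Nat.not_odd_iff_even] at h
      exact ((ZMod.natCast_eq_zero_iff_even).2 h).symm
  -- Whether the ray hits the facet opposite vertex `i` does not depend on the point of colour `i`,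
  -- so each summand cancels modulo two.
  have hupd : ∀ i c j, hit (Function.update c i j) i ↔ hit c i := by
    intro i c j
    refine exists_congr fun w => and_congr_right fun _ => and_congr_right fun hwi => ?_
    rw [Fin.sum_univ_succAbove _ i, Fin.sum_univ_succAbove _ i, hwi]
    simp
  rw [← ZMod.natCast_eq_zero_iff_even]
  have hfil : (containingChoices x).filter (fun c => ∀ i, c i ∈ X i)
      = (Fintype.piFinset X).filter fun c => c ∈ containingChoices x := by
    ext c
    simp [and_comm]
  rw [hfil, ← sum_boole, sum_congr rfl fun c _ => hind c, sum_comm]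
  exact sum_eq_zero fun i _ => sum_piFinset_eq_zero_of_update X hX i _ fun c j => by
    simp only [hupd]

end System

/-! ### Genericity by nonvanishing determinants -/

section Determinants

/-- As a polynomial in `δ` the determinant has `Z.det` as a coefficient, so it has only finitely
many roots. -/
theorem eventually_det_add_smul_ne_zero {n : Type*} [Fintype n] [DecidableEq n]
    (A Z : Matrix n n ℝ) (hZ : Z.det ≠ 0) : ∀ᶠ δ in 𝓝[>] (0 : ℝ), (A + δ • Z).det ≠ 0 := by
  set p : Polynomial ℝ :=
    (Polynomial.X (R := ℝ) • Z.map Polynomial.C + A.map Polynomial.C).det with hp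
  have hp0 : p ≠ 0 := fun h => hZ (by rw [← Polynomial.coeff_det_X_add_C_card Z A, ← hp, h]; simp)
  have heval : ∀ δ : ℝ, p.eval δ = (A + δ • Z).det := by
    intro δ
    rw [hp, ← Polynomial.coe_evalRingHom, RingHom.map_det]
    congr 1
    ext i j
    simp
    ring
  have hfin : ((p.roots.toFinset : Set ℝ) \ {0}).Finite := (finite_toSet _).subset Set.sdiff_subset
  have hnhds : ((p.roots.toFinset : Set ℝ) \ {0})ᶜ ∈ 𝓝 (0 : ℝ) :=
    hfin.isClosed.isOpen_compl.mem_nhds (by simp)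
  filter_upwards [nhdsWithin_le_nhds hnhds, self_mem_nhdsWithin] with δ hδ hpos
  rw [← heval]
  intro h
  refine hδ ⟨?_, ne_of_gt hpos⟩
  simpa [hp0] using h

variable {d : ℕ}

theorem linearIndependent_iff_det_ne_zero (v : Fin d → EuclideanSpace ℝ (Fin d)) :
    LinearIndependent ℝ v ↔ (Matrix.of fun k j => v k j).det ≠ 0 := by
  rw [← isUnit_iff_ne_zero, ← Matrix.isUnit_iff_isUnit_det, ← Matrix.linearIndependent_rows_iff_isUnit]
  exact (LinearMap.linearIndependent_iff (WithLp.linearEquiv 2 ℝ (Fin d → ℝ)).toLinearMap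
    (LinearEquiv.ker _)).symm

theorem eventually_linearlyGeneric {Λ : Type*} [Finite Λ] (x z : Λ → EuclideanSpace ℝ (Fin d))
    (hz : LinearlyGeneric z) : ∀ᶠ δ in 𝓝[>] (0 : ℝ), LinearlyGeneric fun a => x a + δ • z a := by
  refine eventually_all.2 fun f => ?_
  by_cases hf : Function.Injective f
  · filter_upwards [eventually_det_add_smul_ne_zero (Matrix.of fun k j => x (f k) j) _
      ((linearIndependent_iff_det_ne_zero _).1 (hz f hf))] with δ hδ _
    exact (linearIndependent_iff_det_ne_zero _).2 hδ
  · exact Eventually.of_forall fun _ h => absurd h hf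

theorem linearlyGeneric_moment {Λ : Type*} {t : Λ → ℝ} (ht : Function.Injective t) :
    LinearlyGeneric fun a => WithLp.toLp 2 fun j : Fin d => t a ^ (j : ℕ) := fun _f hf =>
  (linearIndependent_iff_det_ne_zero _).2
    (Matrix.det_vandermonde_ne_zero_iff.2 (ht.comp hf))

/-- Distinct points of the moment curve are generic; rescaling each by its nonzero coefficient in
the dependency of its colour makes the colours sum to zero. -/
theorem exists_linearlyGeneric_sum_eq_zero (d : ℕ) :
    ∃ z : Fin (d + 1) → Fin (d + 1) → EuclideanSpace ℝ (Fin d),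
      LinearlyGeneric (fun p : Fin (d + 1) × Fin (d + 1) => z p.1 p.2) ∧ ∀ i, ∑ j, z i j = 0 := by
  have ht : Function.Injective fun p : Fin (d + 1) × Fin (d + 1) =>
      (((Fintype.equivFin _ p : Fin _) : ℕ) : ℝ) :=
    Nat.cast_injective.comp (Fin.val_injective.comp (Equiv.injective _))
  have hm := linearlyGeneric_moment (d := d) ht
  choose c hc hc0 using fun i => LinearlyGeneric.exists_dependency (hm.comp (g := fun j => (i, j))
    fun _ _ h => congrArg Prod.snd h)
  refine ⟨_, fun f hf => ?_, hc⟩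
  exact (hm f hf).units_smul fun k => Units.mk0 _ (hc0 (f k).1 (f k).2)

/-- Affine independence from the determinant of the homogeneous coordinates. -/
theorem affineIndependent_of_det_ne_zero {p : Fin (d + 1) → EuclideanSpace ℝ (Fin d)} (a : ℝ)
    (h : (Matrix.of fun k => (Fin.cons a (p k) : Fin (d + 1) → ℝ)).det ≠ 0) :
    AffineIndependent ℝ p := by
  rw [affineIndependent_iff_of_fintype]
  intro w hw hwp
  rw [univ.weightedVSub_eq_linear_combination hw] at hwp
  refine congrFun (Matrix.eq_zero_of_vecMul_eq_zero h ?_)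
  funext j
  refine Fin.cases ?_ (fun j => ?_) j
  · simp [Matrix.vecMul, dotProduct, ← sum_mul, hw]
  · have := congrArg (fun v : EuclideanSpace ℝ (Fin d) => v j) hwp
    simpa [Matrix.vecMul, dotProduct] using this

theorem eventually_affineIndependent {Λ : Type*} [Finite Λ]
    (x m : Λ → EuclideanSpace ℝ (Fin d)) {t : Λ → ℝ} (ht : Function.Injective t)
    (hm : ∀ a j, m a j = t a ^ ((j : ℕ) + 1)) :
    ∀ᶠ δ in 𝓝[>] (0 : ℝ), ∀ f : Fin (d + 1) → Λ, Function.Injective f →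
      AffineIndependent ℝ fun k => x (f k) + δ • m (f k) := by
  refine eventually_all.2 fun f => ?_
  by_cases hf : Function.Injective f
  · have hdet := Matrix.det_vandermonde_ne_zero_iff.2 (ht.comp hf)
    filter_upwards [eventually_det_add_smul_ne_zero
      (Matrix.of fun k => (Fin.cons 1 (x (f k)) : Fin (d + 1) → ℝ)) _ hdet] with δ hδ _
    -- The homogeneous coordinate 1 gains `δ` from the zeroth power in the Vandermonde row.
    refine affineIndependent_of_det_ne_zero (1 + δ) ?_
    convert hδ using 2
    ext k j
    refine Fin.cases ?_ (fun j => ?_) j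
    · simp [Matrix.vandermonde_apply]
    · simp [Matrix.vandermonde_apply, hm]
  · exact Eventually.of_forall fun _ h => absurd h hf

end Determinants

/-! ### Stability under small perturbations -/

section Openness

variable {d : ℕ}

/-- The set is a projection of a closed set along the compact simplex of weights. -/
theorem isClosed_setOf_zero_mem_convexHull {ι E : Type*} [Fintype ι] [NormedAddCommGroup E]
    [NormedSpace ℝ E] : IsClosed {s : ι → E | (0 : E) ∈ convexHull ℝ (Set.range s)} := by
  have hcl : IsClosed {q : (ι → E) × stdSimplex ℝ ι | ∑ i, (q.2 : ι → ℝ) i • q.1 i = 0} :=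
    isClosed_eq (continuous_finsetSum _ fun i _ =>
      ((continuous_apply i).comp (continuous_subtype_val.comp continuous_snd)).smul
        ((continuous_apply i).comp continuous_fst)) continuous_const
  convert isClosedMap_fst_of_compactSpace _ hcl using 1
  ext s
  simp only [Set.mem_ofPred_eq, mem_convexHull_range_iff, Set.mem_image, Prod.exists]
  constructor
  · rintro ⟨w, hw, h⟩
    exact ⟨s, ⟨w, hw⟩, h, rfl⟩
  · rintro ⟨s', w, h, rfl⟩
    exact ⟨w, w.2, h⟩

theorem eventually_containingChoices_subset
    (x : Fin (d + 1) → Fin (d + 1) → EuclideanSpace ℝ (Fin d)) :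
    ∀ᶠ y in 𝓝 x, containingChoices y ⊆ containingChoices x := by
  have h : ∀ c, ∀ᶠ y in 𝓝 x, c ∈ containingChoices y → c ∈ containingChoices x := by
    intro c
    by_cases hc : c ∈ containingChoices x
    · exact Eventually.of_forall fun _ _ => hc
    · have hcont : Continuous fun (y : Fin (d + 1) → Fin (d + 1) → EuclideanSpace ℝ (Fin d)) k =>
        y k (c k) := by fun_prop
      have hopen := (isClosed_setOf_zero_mem_convexHull (ι := Fin (d + 1))
        (E := EuclideanSpace ℝ (Fin d))).isOpen_compl.preimage hcont
      filter_upwards [hopen.mem_nhds fun h => hc (mem_containingChoices.2 h)] with y hy hcy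
      exact absurd (mem_containingChoices.1 hcy) hy
  filter_upwards [eventually_all.2 h] with y hy c using hy c

theorem zero_mem_convexHull_of_smul {ι E : Type*} [Fintype ι] [AddCommGroup E] [Module ℝ E]
    {s : ι → E} {a : ι → ℝ} (ha : ∀ i, 0 < a i)
    (h : (0 : E) ∈ convexHull ℝ (Set.range fun i => a i • s i)) :
    (0 : E) ∈ convexHull ℝ (Set.range s) := by
  rw [zero_mem_convexHull_range_iff] at h ⊢
  obtain ⟨w, hw, ⟨i, hi⟩, hsum⟩ := h
  refine ⟨fun i => w i * a i, fun i => mul_nonneg (hw i) (ha i).le,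
    ⟨i, mul_ne_zero hi (ha i).ne'⟩, ?_⟩
  simpa [mul_smul] using hsum

/-- A simplex with the origin in its interior keeps it under small perturbations. -/
theorem LinearlyGeneric.eventually_zero_mem_convexHull
    {s : Fin (d + 1) → EuclideanSpace ℝ (Fin d)} (hs : LinearlyGeneric s) (hsum : ∑ j, s j = 0) :
    ∀ᶠ s' in 𝓝 s, (0 : EuclideanSpace ℝ (Fin d)) ∈ convexHull ℝ (Set.range s') := by
  -- By compactness of the sphere, the families lying in some closed half-space bounded by a
  -- hyperplane through the origin form a closed set. It does not contain `s`, but by separation it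
  -- contains every family whose hull misses the origin.
  have hcl : IsClosed {q : (Fin (d + 1) → EuclideanSpace ℝ (Fin d)) ×
      Metric.sphere (0 : EuclideanSpace ℝ (Fin d)) 1 |
      ∀ j, 0 ≤ inner ℝ (q.2 : EuclideanSpace ℝ (Fin d)) (q.1 j)} := by
    simp only [Set.ofPred_forall]
    exact isClosed_iInter fun j => isClosed_le continuous_const (by fun_prop)
  have hopen := (isClosedMap_fst_of_compactSpace _ hcl).isOpen_compl
  have hnot : s ∈ (Prod.fst '' {q : (Fin (d + 1) → EuclideanSpace ℝ (Fin d)) ×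
      Metric.sphere (0 : EuclideanSpace ℝ (Fin d)) 1 |
      ∀ j, 0 ≤ inner ℝ (q.2 : EuclideanSpace ℝ (Fin d)) (q.1 j)})ᶜ := by
    rintro ⟨⟨s', v⟩, hv, rfl⟩
    have hv0 : -(v : EuclideanSpace ℝ (Fin d)) ≠ 0 := by
      rw [neg_ne_zero, ← norm_ne_zero_iff, norm_eq_of_mem_sphere]
      exact one_ne_zero
    obtain ⟨j, hj⟩ := hs.exists_inner_pos hsum hv0
    rw [inner_neg_left] at hj
    have := hv j
    simp only at this hj
    linarith
  filter_upwards [hopen.mem_nhds hnot] with s' hs'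
  by_contra h0
  obtain ⟨f, u, hf0, hfu⟩ := geometric_hahn_banach_point_closed (convex_convexHull ℝ _)
    ((Set.finite_range s').isClosed_convexHull ℝ) h0
  rw [map_zero] at hf0
  have hpos : ∀ j, 0 < f (s' j) := fun j =>
    hf0.trans (hfu _ (subset_convexHull ℝ _ (Set.mem_range_self j)))
  set v := (InnerProductSpace.toDual ℝ (EuclideanSpace ℝ (Fin d))).symm f with hv
  have hvf : ∀ y, inner ℝ v y = f y := fun y => InnerProductSpace.toDual_symm_apply
  have hv0 : v ≠ 0 := fun h => by
    have := hpos 0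
    rw [← hvf, h, inner_zero_left] at this
    exact lt_irrefl _ this
  refine hs' ⟨⟨s', ⟨‖v‖⁻¹ • v, by simp [norm_smul, hv0]⟩⟩, fun j => ?_, rfl⟩
  simp only [real_inner_smul_left, hvf]
  exact mul_nonneg (by positivity) (hpos j).le

end Openness

/-! ### Perturbing to generic and general position -/

section Perturbation

variable {d : ℕ} {x : Fin (d + 1) → Fin (d + 1) → EuclideanSpace ℝ (Fin d)}

/-- A colourful configuration can be perturbed, up to positive scaling, to one all of whose colours
sum to zero, without creating simplices containing the origin. -/
theorem exists_sum_eq_zero_containingChoices_subset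
    (hx : ∀ i, (0 : EuclideanSpace ℝ (Fin d)) ∈ convexHull ℝ (Set.range (x i))) :
    ∃ y : Fin (d + 1) → Fin (d + 1) → EuclideanSpace ℝ (Fin d),
      (∀ i, ∑ j, y i j = 0) ∧ containingChoices y ⊆ containingChoices x := by
  choose w hw hw0 hwx using fun i => (zero_mem_convexHull_range_iff (x i)).1 (hx i)
  choose l hl using hw0
  -- One point of positive weight per colour is moved so that the weights `w i j + ε`, now all
  -- positive, give a dependency; rescaling by them then makes the sum zero.
  let x₁ : ℝ → Fin (d + 1) → Fin (d + 1) → EuclideanSpace ℝ (Fin d) := fun ε i j =>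
    x i j - if j = l i then (ε / (w i j + ε)) • ∑ k, x i k else 0
  have hx₁ : Tendsto x₁ (𝓝[>] 0) (𝓝 x) := by
    refine tendsto_pi_nhds.2 fun i => tendsto_pi_nhds.2 fun j => ?_
    by_cases hj : j = l i
    · have hcont : ContinuousAt (fun ε : ℝ => x i j - (ε / (w i j + ε)) • ∑ k, x i k) 0 := by
        refine continuousAt_const.sub (ContinuousAt.smul (ContinuousAt.div continuousAt_id
          (continuousAt_const.add continuousAt_id) ?_) continuousAt_const)
        simpa [hj] using hl i
      have := hcont.tendsto
      simp only [zero_div, zero_smul, sub_zero] at this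
      simpa [x₁, hj] using this.mono_left nhdsWithin_le_nhds
    · simp [x₁, hj]
  obtain ⟨ε, hε, hεpos⟩ := ((hx₁.eventually (eventually_containingChoices_subset x)).and
    self_mem_nhdsWithin).exists
  replace hεpos : 0 < ε := hεpos
  have hpos : ∀ i j, 0 < w i j + ε := fun i j => add_pos_of_nonneg_of_pos (hw i j) hεpos
  let x₂ : Fin (d + 1) → Fin (d + 1) → EuclideanSpace ℝ (Fin d) := fun i j =>
    (w i j + ε) • x₁ ε i j
  have hx₂ : ∀ i, ∑ j, x₂ i j = 0 := by
    intro i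
    have hterm : ∀ j, x₂ i j = w i j • x i j + ε • x i j
        - if j = l i then ε • ∑ k, x i k else 0 := by
      intro j
      simp only [x₂, x₁, smul_sub, add_smul]
      congr 1
      by_cases hj : j = l i
      · rw [if_pos hj, if_pos hj, ← add_smul, smul_smul, mul_div_cancel₀ _ (hpos i j).ne']
      · simp [hj]
    simp_rw [hterm]
    rw [sum_sub_distrib, sum_add_distrib, hwx, ← smul_sum]
    simp
  have hsub₂ : containingChoices x₂ ⊆ containingChoices (x₁ ε) := fun c hc =>
    mem_containingChoices.2 (zero_mem_convexHull_of_smul (fun k => hpos k (c k))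
      (mem_containingChoices.1 hc))
  exact ⟨x₂, hx₂, hsub₂.trans hε⟩

/-- A colourful configuration can be perturbed, up to positive scaling, to a generic one all of
whose colours sum to zero, without creating simplices containing the origin. -/
theorem exists_linearlyGeneric_containingChoices_subset
    (hx : ∀ i, (0 : EuclideanSpace ℝ (Fin d)) ∈ convexHull ℝ (Set.range (x i))) :
    ∃ y : Fin (d + 1) → Fin (d + 1) → EuclideanSpace ℝ (Fin d),
      LinearlyGeneric (fun p : Fin (d + 1) × Fin (d + 1) => y p.1 p.2) ∧
      (∀ i, ∑ j, y i j = 0) ∧ containingChoices y ⊆ containingChoices x := by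
  obtain ⟨x₂, hx₂, hsub₂⟩ := exists_sum_eq_zero_containingChoices_subset hx
  obtain ⟨z, hz, hz0⟩ := exists_linearlyGeneric_sum_eq_zero d
  have hlim : Tendsto (fun δ : ℝ => fun i j => x₂ i j + δ • z i j) (𝓝[>] 0) (𝓝 x₂) := by
    have hcont : Continuous fun (δ : ℝ) i j => x₂ i j + δ • z i j := by fun_prop
    have := hcont.tendsto 0
    simp only [zero_smul, add_zero] at this
    exact this.mono_left nhdsWithin_le_nhds
  obtain ⟨δ, hδ, hgen⟩ := ((hlim.eventually (eventually_containingChoices_subset x₂)).and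
    (eventually_linearlyGeneric (fun p : Fin (d + 1) × Fin (d + 1) => x₂ p.1 p.2) (fun p => z p.1 p.2) hz)).exists
  refine ⟨fun i j => x₂ i j + δ • z i j, hgen, fun i => ?_, hδ.trans hsub₂⟩
  rw [sum_add_distrib, hx₂, ← smul_sum, hz0, smul_zero, add_zero]

/-- The origin and the points of a configuration. -/
def pointOrZero (x : Fin (d + 1) → Fin (d + 1) → EuclideanSpace ℝ (Fin d)) :
    Option (Fin (d + 1) × Fin (d + 1)) → EuclideanSpace ℝ (Fin d) :=
  fun o => o.elim 0 fun p => x p.1 p.2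

theorem LinearlyGeneric.exists_affineIndependent
    (hx : LinearlyGeneric fun p : Fin (d + 1) × Fin (d + 1) => x p.1 p.2)
    (hsum : ∀ i, ∑ j, x i j = 0) :
    ∃ y : Fin (d + 1) → Fin (d + 1) → EuclideanSpace ℝ (Fin d),
      (∀ f : Fin (d + 1) → Option (Fin (d + 1) × Fin (d + 1)), Function.Injective f →
        AffineIndependent ℝ fun k => pointOrZero y (f k)) ∧
      (∀ i, (0 : EuclideanSpace ℝ (Fin d)) ∈ convexHull ℝ (Set.range (y i))) ∧
      containingChoices y ⊆ containingChoices x := by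
  -- The origin gets parameter 0 and the powers start at 1, so the perturbation fixes it.
  let t : Option (Fin (d + 1) × Fin (d + 1)) → ℝ := fun o =>
    o.elim 0 fun p => (((Fintype.equivFin _ p : Fin _) : ℕ) : ℝ) + 1
  have ht : Function.Injective t := by
    rintro (_ | p) (_ | q) h
    · rfl
    · exact absurd h (by simp only [t, Option.elim]; positivity)
    · exact absurd h (by simp only [t, Option.elim]; positivity)
    · simp only [t, Option.elim, add_left_inj, Nat.cast_inj] at h
      rw [(Fintype.equivFin _).injective (Fin.val_injective h)]
  let m : Option (Fin (d + 1) × Fin (d + 1)) → EuclideanSpace ℝ (Fin d) := fun o =>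
    WithLp.toLp 2 fun j => t o ^ ((j : ℕ) + 1)
  have hm0 : m none = 0 := by
    ext j
    simp [m, t]
  let y : ℝ → Fin (d + 1) → Fin (d + 1) → EuclideanSpace ℝ (Fin d) := fun δ i j =>
    x i j + δ • m (some (i, j))
  have hlim : Tendsto y (𝓝[>] 0) (𝓝 x) := by
    have hcont : Continuous y := by fun_prop
    have := hcont.tendsto 0
    simp only [y, zero_smul, add_zero] at this
    exact this.mono_left nhdsWithin_le_nhds
  have hhull : ∀ i, ∀ᶠ y in 𝓝 x, (0 : EuclideanSpace ℝ (Fin d)) ∈ convexHull ℝ (Set.range (y i)) :=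
    fun i => (continuous_apply i).continuousAt.eventually
      ((hx.colour i).eventually_zero_mem_convexHull (hsum i))
  obtain ⟨δ, ⟨hsub, hmem⟩, hai⟩ := ((hlim.eventually
    ((eventually_containingChoices_subset x).and (eventually_all.2 hhull))).and
    (eventually_affineIndependent (pointOrZero x) m ht fun _ _ => rfl)).exists
  refine ⟨y δ, fun f hf => ?_, hmem, hsub⟩
  convert hai f hf using 2 with k
  rcases f k with _ | p
  · simp [pointOrZero, hm0]
  · rfl

end Perturbation

/-! ### From labelled points to colourful configurations -/

section Configurations

variable {d : ℕ}

/-- Since `1 ≤ d`, any two labels fit into a set of `d + 1` labels. -/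
theorem injective_of_forall_affineIndependent {Λ : Type*} [Fintype Λ] [DecidableEq Λ] (hd : 1 ≤ d)
    (hΛ : d + 1 ≤ Fintype.card Λ) {p : Λ → EuclideanSpace ℝ (Fin d)}
    (hp : ∀ U : Finset Λ, U.card = d + 1 → AffineIndependent ℝ fun a : U => p a) :
    Function.Injective p := by
  intro a b hab
  obtain ⟨U, hU, hUc⟩ := exists_superset_card_eq (s := {a, b}) (n := d + 1)
    (card_le_two.trans (by omega)) (by simpa using hΛ)
  have := (hp U hUc).injective (a₁ := ⟨a, hU (by simp)⟩) (a₂ := ⟨b, hU (by simp)⟩) hab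
  simpa using this

theorem affineIndependent_of_card_le {Λ : Type*} [Fintype Λ] [DecidableEq Λ] (hd : 1 ≤ d)
    (hΛ : d + 1 ≤ Fintype.card Λ) {p : Λ → EuclideanSpace ℝ (Fin d)}
    (hp : ∀ U : Finset Λ, U.card = d + 1 → AffineIndependent ℝ fun a : U => p a)
    {T : Finset (EuclideanSpace ℝ (Fin d))} (hT : ∀ x ∈ T, ∃ a, p a = x) (hcard : T.card ≤ d + 1) :
    AffineIndependent ℝ fun x : T => (x : EuclideanSpace ℝ (Fin d)) := by
  have hinj := injective_of_forall_affineIndependent hd hΛ hp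
  choose g hg using hT
  have hginj : Function.Injective fun x : T => g x x.2 := fun x y h => by
    have := congrArg p h
    simp only [hg] at this
    exact Subtype.ext this
  obtain ⟨U, hU, hUc⟩ := exists_superset_card_eq (s := univ.image fun x : T => g x x.2) (n := d + 1)
    (card_image_le.trans (by simpa using hcard)) (by simpa using hΛ)
  have := (hp U hUc).comp_embedding
    ⟨fun x : T => ⟨g x x.2, hU (mem_image_of_mem _ (mem_univ x))⟩, fun x y h =>
      hginj (congrArg Subtype.val h)⟩
  convert this using 2 with x
  exact (hg x x.2).symm

theorem colourfulDepth_image {x : Fin (d + 1) → Fin (d + 1) → EuclideanSpace ℝ (Fin d)}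
    (hx : ∀ i, Function.Injective (x i)) {S : Fin (d + 1) → Finset (EuclideanSpace ℝ (Fin d))}
    (hS : ∀ i, (S i : Set (EuclideanSpace ℝ (Fin d))) = Set.range (x i)) :
    colourfulDepth d S = (containingChoices x).card := by
  classical
  symm
  refine card_bij (fun c _ i => x i (c i)) ?_ ?_ ?_
  · intro c hc
    refine mem_filter.2 ⟨Fintype.mem_piFinset.2 fun i => ?_, mem_containingChoices.1 hc⟩
    rw [← mem_coe, hS]
    exact ⟨c i, rfl⟩
  · intro c _ c' _ h
    exact funext fun i => hx i (congrFun h i)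
  · intro s hs
    rw [mem_filter, Fintype.mem_piFinset] at hs
    have : ∀ i, ∃ j, x i j = s i := fun i => by
      have := hs.1 i
      rwa [← mem_coe, hS] at this
    choose c hc using this
    refine ⟨c, mem_containingChoices.2 ?_, funext hc⟩
    simpa only [hc] using hs.2

theorem IsColourfulConfiguration.exists_enumeration
    {S : Fin (d + 1) → Finset (EuclideanSpace ℝ (Fin d))} (hS : IsColourfulConfiguration d S) :
    ∃ x : Fin (d + 1) → Fin (d + 1) → EuclideanSpace ℝ (Fin d),
      (∀ i, (0 : EuclideanSpace ℝ (Fin d)) ∈ convexHull ℝ (Set.range (x i))) ∧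
      colourfulDepth d S = (containingChoices x).card := by
  let x : Fin (d + 1) → Fin (d + 1) → EuclideanSpace ℝ (Fin d) := fun i j =>
    ((S i).equivFinOfCardEq (hS.card_eq i)).symm j
  have hr : ∀ i, (S i : Set (EuclideanSpace ℝ (Fin d))) = Set.range (x i) := fun i => by
    ext y
    constructor
    · intro hy
      exact ⟨(S i).equivFinOfCardEq (hS.card_eq i) ⟨y, hy⟩, by simp [x]⟩
    · rintro ⟨j, rfl⟩
      exact Subtype.prop _
  exact ⟨x, fun i => hr i ▸ hS.zero_mem i, colourfulDepth_image
    (fun i => Subtype.val_injective.comp (Equiv.injective _)) hr⟩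

/-- A configuration of labelled points yields one in general position of no larger depth. -/
theorem exists_isInGeneralPosition (hd : 1 ≤ d)
    {x : Fin (d + 1) → Fin (d + 1) → EuclideanSpace ℝ (Fin d)}
    (hx : ∀ i, (0 : EuclideanSpace ℝ (Fin d)) ∈ convexHull ℝ (Set.range (x i))) :
    ∃ S, IsColourfulConfiguration d S ∧ IsInGeneralPosition d S ∧
      colourfulDepth d S ≤ (containingChoices x).card := by
  classical
  obtain ⟨z, hz, hz0, hzx⟩ := exists_linearlyGeneric_containingChoices_subset hx
  obtain ⟨y, hy, hy0, hyz⟩ := hz.exists_affineIndependent hz0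
  have hU : ∀ U : Finset (Option (Fin (d + 1) × Fin (d + 1))), U.card = d + 1 →
      AffineIndependent ℝ fun a : U => pointOrZero y a := fun U hU => by
    let e := U.equivFinOfCardEq hU
    have := (hy (fun k => e.symm k) (Subtype.val_injective.comp e.symm.injective)).comp_embedding
      e.toEmbedding
    convert this using 2 with a
    simp
  have hΛ : d + 1 ≤ Fintype.card (Option (Fin (d + 1) × Fin (d + 1))) := by
    simp only [Fintype.card_option, Fintype.card_prod, Fintype.card_fin]
    nlinarith
  have hinj := injective_of_forall_affineIndependent hd hΛ hU
  have hyinj : ∀ i, Function.Injective (y i) := fun i j k h => by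
    simpa using hinj (a₁ := some (i, j)) (a₂ := some (i, k)) h
  have hS : ∀ i, ((univ.image (y i) : Finset _) : Set (EuclideanSpace ℝ (Fin d)))
      = Set.range (y i) := fun i => by simp
  refine ⟨fun i => univ.image (y i), ⟨fun i => ?_, fun i => (hS i).symm ▸ hy0 i⟩, ⟨fun i h => ?_,
    fun i k hik => ?_, fun T hT hcard => affineIndependent_of_card_le hd hΛ hU (fun v hv => ?_)
      hcard⟩, ?_⟩
  · rw [card_image_of_injective _ (hyinj i), card_univ, Fintype.card_fin]
  · obtain ⟨j, -, hj⟩ := mem_image.1 h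
    simpa using hinj (a₁ := some (i, j)) (a₂ := none) hj
  · rw [Finset.disjoint_left]
    intro v hv hv'
    obtain ⟨j, -, rfl⟩ := mem_image.1 hv
    obtain ⟨l, -, hl⟩ := mem_image.1 hv'
    have := hinj (a₁ := some (k, l)) (a₂ := some (i, j)) hl
    simp only [Option.some.injEq, Prod.mk.injEq] at this
    exact hik this.1.symm
  · rcases hT v hv with rfl | ⟨i, hi⟩
    · exact ⟨none, rfl⟩
    · obtain ⟨j, -, rfl⟩ := mem_image.1 hi
      exact ⟨some (i, j), rfl⟩
  · rw [colourfulDepth_image hyinj hS]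
    exact card_le_card (hyz.trans hzx)

end Configurations

/-! ### Dimension four -/

section DimensionFour

/-- Five points of each of five colours have an octahedral system of containing simplices, after a
perturbation. -/
theorem exists_octahedralSystem {x : Fin 5 → Fin 5 → EuclideanSpace ℝ (Fin 4)}
    (hx : ∀ i, (0 : EuclideanSpace ℝ (Fin 4)) ∈ convexHull ℝ (Set.range (x i))) :
    ∃ Ω : OctahedralSystem (fun _ : Fin 5 => 5), Ω.WithoutIsolatedVertex ∧
      Ω.edges.card ≤ (containingChoices x).card := by
  obtain ⟨y, hy, hy0, hyx⟩ := exists_linearlyGeneric_containingChoices_subset hx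
  refine ⟨⟨containingChoices y, fun _ => by norm_num, fun X hX => ?_⟩, fun i v => ?_,
    card_le_card hyx⟩
  · convert hy.even_card_containingChoices X hX
  · obtain ⟨c, hc, h⟩ := hy.exists_mem_convexHull_transversal hy0 i v
    exact ⟨c, mem_containingChoices.2 h, hc⟩

theorem OctahedralSystem.seventeen_le_card (Ω : OctahedralSystem (fun _ : Fin 5 => 5))
    (hΩ : Ω.WithoutIsolatedVertex) : 17 ≤ Ω.edges.card :=
  IsOctahedral.seventeen_le_card (fun X hX => by convert Ω.parity X hX) hΩ

theorem seventeen_le_card_containingChoices {x : Fin 5 → Fin 5 → EuclideanSpace ℝ (Fin 4)}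
    (hx : ∀ i, (0 : EuclideanSpace ℝ (Fin 4)) ∈ convexHull ℝ (Set.range (x i))) :
    17 ≤ (containingChoices x).card := by
  obtain ⟨Ω, hΩ, hle⟩ := exists_octahedralSystem hx
  exact (Ω.seventeen_le_card hΩ).trans hle

/-- The coordinates of a degenerate configuration of depth seventeen: one colour consists of the
vertices of a simplex, and each other colour of a unit vector and four copies of its opposite. -/
def seventeenCoord (i j : Fin 5) (k : Fin 4) : ℤ :=
  if i = 0 then (if j = k.succ then 4 else -1)
  else if i = k.succ then (if j = 0 then 1 else -1) else 0

/-- The points with coordinates `seventeenCoord`. -/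
noncomputable def seventeenPoint (i j : Fin 5) : EuclideanSpace ℝ (Fin 4) :=
  WithLp.toLp 2 fun k => (seventeenCoord i j k : ℝ)

theorem zero_mem_convexHull_seventeenPoint (i : Fin 5) :
    (0 : EuclideanSpace ℝ (Fin 4)) ∈ convexHull ℝ (Set.range (seventeenPoint i)) := by
  have h : ∀ (i : Fin 5) (k : Fin 4),
      ∑ j, (if i = 0 ∨ j = 0 ∨ j = 1 then 1 else 0) * seventeenCoord i j k = 0 := by decide
  refine (zero_mem_convexHull_range_iff _).2
    ⟨fun j => ((if i = 0 ∨ j = 0 ∨ j = 1 then 1 else 0 : ℤ) : ℝ), fun j => ?_, ⟨0, by simp⟩, ?_⟩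
  · beta_reduce
    split_ifs <;> simp
  · ext k
    have := congrArg (Int.cast : ℤ → ℝ) (h i k)
    rw [Int.cast_sum] at this
    simpa only [seventeenPoint, WithLp.ofLp_sum, WithLp.ofLp_smul, Finset.sum_apply, Pi.smul_apply,
      smul_eq_mul, Int.cast_mul, Int.cast_zero, PiLp.zero_apply] using this

theorem card_containingChoices_seventeenPoint_le :
    (containingChoices seventeenPoint).card ≤ 17 := by
  -- Containment needs opposite signs in every coordinate. The vertex of colour `0` with all
  -- coordinates `-1` leaves one choice; the vertex with 4 in coordinate `k` leaves four choices in
  -- colour `k.succ` and one in each other. In total `1 + 4 * 4 = 17`.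
  have hcard : (univ.filter fun c : Fin 5 → Fin 5 =>
      ∀ k : Fin 4, seventeenCoord 0 (c 0) k * seventeenCoord k.succ (c k.succ) k < 0).card ≤ 17 := by
    decide +kernel
  refine (card_le_card fun c hc => mem_filter.2 ⟨mem_univ c, ?_⟩).trans hcard
  obtain ⟨w, hw, ⟨i, hi⟩, hsum⟩ := (zero_mem_convexHull_range_iff _).1 (mem_containingChoices.1 hc)
  have hcoord : ∀ k : Fin 4, w 0 * seventeenCoord 0 (c 0) k
      + w k.succ * seventeenCoord k.succ (c k.succ) k = 0 := by
    intro k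
    have := congrArg (fun v : EuclideanSpace ℝ (Fin 4) => v k) hsum
    simp only [seventeenPoint, WithLp.ofLp_sum, WithLp.ofLp_smul, Finset.sum_apply, Pi.smul_apply,
      smul_eq_mul, PiLp.zero_apply] at this
    rw [Fin.sum_univ_succ, sum_eq_single k] at this
    · exact this
    · intro l _ hl
      simp [seventeenCoord, hl, Fin.succ_ne_zero]
    · simp
  have hsq : ∀ (k : Fin 4) (j : Fin 5), seventeenCoord k.succ j k * seventeenCoord k.succ j k = 1 := by
    decide
  have hne : ∀ (k : Fin 4) (j : Fin 5), seventeenCoord 0 j k ≠ 0 := by decide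
  have hw0 : w 0 ≠ 0 := by
    intro h0
    refine hi (Fin.cases h0 (fun k => ?_) i)
    have h1 := hcoord k
    have h2 := congrArg (Int.cast : ℤ → ℝ) (hsq k (c k.succ))
    push_cast at h2
    rw [h0, zero_mul, zero_add] at h1
    rcases mul_eq_zero.1 h1 with h | h
    · exact h
    · rw [h] at h2; norm_num at h2
  have hw0pos : 0 < w 0 := lt_of_le_of_ne (hw 0) hw0.symm
  intro k
  have h1 := hcoord k
  have h2 := congrArg (Int.cast : ℤ → ℝ) (hsq k (c k.succ))
  push_cast at h2
  have h3 : w 0 * ((seventeenCoord 0 (c 0) k : ℝ) * seventeenCoord k.succ (c k.succ) k) ≤ 0 := by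
    have : w 0 * ((seventeenCoord 0 (c 0) k : ℝ) * seventeenCoord k.succ (c k.succ) k)
        = - w k.succ := by
      linear_combination (seventeenCoord k.succ (c k.succ) k : ℝ) * h1 - w k.succ * h2
    rw [this]
    exact neg_nonpos.2 (hw _)
  have h4 : seventeenCoord 0 (c 0) k * seventeenCoord k.succ (c k.succ) k ≤ 0 := by
    have := nonpos_of_mul_nonpos_right h3 hw0pos
    exact_mod_cast this
  refine lt_of_le_of_ne h4 (mul_ne_zero (hne _ _) fun h => ?_)
  have := hsq k (c k.succ)
  rw [h] at this
  norm_num at this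

end DimensionFour

theorem mainTheorem2 :
    mu 4 = 17 ∧ muGeneralPosition 4 = 17 ∧ nu ![5, 5, 5, 5, 5] = 17 := by
  have hlower : ∀ S, IsColourfulConfiguration 4 S → 17 ≤ colourfulDepth 4 S := fun S hS => by
    obtain ⟨x, hx, h⟩ := hS.exists_enumeration
    exact h ▸ seventeen_le_card_containingChoices hx
  -- Because of its repeated points, `seventeenPoint` itself is not a colourful configuration; its
  -- perturbation is, and attains both geometric minima.
  obtain ⟨S, hS, hSg, hle⟩ := exists_isInGeneralPosition (by norm_num)
    zero_mem_convexHull_seventeenPoint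
  have hS17 : colourfulDepth 4 S = 17 :=
    le_antisymm (hle.trans card_containingChoices_seventeenPoint_le) (hlower S hS)
  refine ⟨le_antisymm (Nat.sInf_le ⟨S, hS, hS17⟩) (le_csInf ⟨17, S, hS, hS17⟩ ?_),
    le_antisymm (Nat.sInf_le ⟨S, hS, hSg, hS17⟩) (le_csInf ⟨17, S, hS, hSg, hS17⟩ ?_), ?_⟩
  · rintro k ⟨S, hS, rfl⟩
    exact hlower S hS
  · rintro k ⟨S, hS, -, rfl⟩
    exact hlower S hS
  · have hm : (![5, 5, 5, 5, 5] : Fin 5 → ℕ) = fun _ => 5 := by decide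
    rw [hm]
    obtain ⟨Ω, hΩ, hΩle⟩ := exists_octahedralSystem zero_mem_convexHull_seventeenPoint
    have hΩ17 : Ω.edges.card = 17 :=
      le_antisymm (hΩle.trans card_containingChoices_seventeenPoint_le) (Ω.seventeen_le_card hΩ)
    refine le_antisymm (Nat.sInf_le ⟨Ω, hΩ, hΩ17⟩) (le_csInf ⟨17, Ω, hΩ, hΩ17⟩ ?_)
    rintro k ⟨Ω, hΩ, rfl⟩
    exact Ω.seventeen_le_card hΩ
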